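/- **Setting.** Let $m,n\ge 0$ be integers, $S\subseteq\mathbb R^m$ a nonempty bounded convex set and $Z\subseteq\mathbb R^n$ a bounded set. A stagewise convex problem over $S$ is $$\min_{(s,z)\in S\times\mathbb R^n} f(s,z)\quad\text{s.t.}\quad \mu_i(s,z_{1:i-1})\le z_i\le \eta_i(s,z_{1:i-1}),\quad i=1,\dots,n, \qquad (\mathrm P)$$ where $f:S\times\mathbb R^n\to\mathbb R$ and $\mu_i:S\times\mathbb R^{i-1}\to\mathbb R$ are convex and $\eta_i:S\times\mathbb R^{i-1}\to\mathbb R$ are concave. Write $a^+=\max\{a,0\}$ and $a^-=\max\{-a,0\}$. For $(s,\theta)\in S\times[0,1]^n$ let $z=\mathrm{Forward}(s,\theta)$ be given by $z_i=(1-\theta_i)\mu_i(s,z_{1:i-1})+\theta_i\eta_i(s,z_{1:i-1})$. Let $\psi_n=f$ and, for $i=n,\dots,1$, $$\psi_{i-1}(s,z_{1:i-1},\theta_{i:n})=\psi_i\big(s,z_{1:i-1},(1-\theta_i)\mu_i(s,z_{1:i-1})+\theta_i\eta_i(s,z_{1:i-1}),\theta_{i+1:n}\big),$$ so that $\psi_0(s,\theta)=f(s,\mathrm{Forward}(s,\theta))$.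 The Lagrangian is $\mathcal L(s,z,y)=f(s,z)+\sum_{i=1}^n\big(y_i^+\mu_i(s,z_{1:i-1})-y_i^-\eta_i(s,z_{1:i-1})-y_iz_i\big)$, and the duality gap at $(s,\theta)$ is $$\Delta(s,\theta)=\sum_{i=1}^n\big(y_iz_i-y_i^+\mu_i+y_i^-\eta_i\big)+\sup_{(\hat s,\hat z)\in S\times Z}\nabla_{s,z}\mathcal L(s,z,y)\cdot(s-\hat s,\,z-\hat z),$$ with $z=\mathrm{Forward}(s,\theta)$, $\mu_i,\eta_i$ evaluated at $(s,z_{1:i-1})$, and $y_i=\partial\psi_i/\partial z_i$ evaluated at $(s,z_{1:i},\theta_{i+1:n})$. A function is called smooth on its domain if it has a gradient (relative to the domain) at every point of the domain and this gradient is Lipschitz continuous on the bounded subsets of the domain. An algorithm is a deterministic procedure that knows $m$, $n$, $S$, $Z$ and the tolerance $\varepsilon$, and learns about $f,\mu_i,\eta_i$ only through computations of $\nabla\psi_0$ at points $(s,\theta)\in S\times[0,1]^n$ of its choice. One computation of $\nabla\psi_0(s,\theta)$ is one forward and backward pass: it reveals $z=\mathrm{Forward}(s,\theta)$, $\nabla\psi_0(s,\theta)$,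 and the values and gradients of $f$, $\mu_i$, $\eta_i$ at $z$ and $s$ (with no other access to these functions). **Theorem.** There is an algorithm such that the following holds for every stagewise convex problem over $S$ for which 1. $f$, $\mu_1,\dots,\mu_n$, $\eta_1,\dots,\eta_n$ are smooth, 2. $z\in Z$ for every feasible point $(s,z)$ of $(\mathrm P)$, 3. for all $i\in\{1,\dots,n\}$, if $s\in S$ and $\mu_j(s,z_{1:j-1})\le z_j\le\eta_j(s,z_{1:j-1})$ for all $j<i$, then $\mu_i(s,z_{1:i-1})\le\eta_i(s,z_{1:i-1})$. There is a constant $C$, depending on the problem but not on $\varepsilon$, such that for every $\varepsilon>0$ the algorithm terminates after at most $C\varepsilon^{-3}+1$ computations of $\nabla\psi_0$ and returns a point $(s,\theta)\in S\times[0,1]^n$ with an $\varepsilon$-duality gap: with $z=\mathrm{Forward}(s,\theta)$ and $y_i=\partial\psi_i/\partial z_i$ as above, $(s,z)$ is feasible for $(\mathrm P)$, $\Delta(s,\theta)\le\varepsilon$, and consequently $f(s,z)-\varepsilon\le\mathcal L(\hat s,\hat z,y)$ for all $(\hat s,\hat z)\in S\times Z$ and $f(s,z)-\varepsilon\le f(\hat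 s,\hat z)$ for all feasible $(\hat s,\hat z)$. -/

import Mathlib

open Set

noncomputable section

/-- `h` is smooth on `X`: it has at every point of `X` a gradient (relative to `X`, as a continuous
linear functional), and this gradient is Lipschitz on the bounded subsets of `X`.
In finite dimension the notion does not depend on the norm. -/
def SmoothOn {E : Type*} [NormedAddCommGroup E] [NormedSpace ℝ E] (X : Set E) (h : E → ℝ) : Prop :=
  ∃ g : E → (E →L[ℝ] ℝ), (∀ x ∈ X, HasFDerivWithinAt h (g x) X x) ∧
    ∀ B ⊆ X, Bornology.IsBounded B → ∃ K : NNReal, LipschitzOnWith K g B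

/-- The functions of a stagewise problem: minimize `f (s, z)` over `s ∈ S`, `z ∈ ℝⁿ` subject to
`μ i (s, z_{<i}) ≤ z i ≤ η i (s, z_{<i})` for every `i`. Indices start at `0`, so that
`μ i` and `η i` are functions of `s` and of the `i` coordinates of `z` before the `i`-th one. -/
structure StageProblem (m n : ℕ) where
  f : (Fin m → ℝ) × (Fin n → ℝ) → ℝ
  μ : (i : Fin n) → (Fin m → ℝ) × (Fin i → ℝ) → ℝ
  η : (i : Fin n) → (Fin m → ℝ) × (Fin i → ℝ) → ℝ

/-- The coordinates of `z` before the `i`-th one. -/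
def before {n : ℕ} (i : Fin n) (z : Fin n → ℝ) : Fin i → ℝ :=
  fun j => z ⟨j, j.2.trans i.2⟩

/-- The domain `S × [0,1]ⁿ` of the nonconvex reformulation. -/
def boxDomain {m : ℕ} (n : ℕ) (S : Set (Fin m → ℝ)) : Set ((Fin m → ℝ) × (Fin n → ℝ)) :=
  S ×ˢ Icc (0 : Fin n → ℝ) 1

/-- The data that one forward and backward pass at a point `(s, θ)` produces, i.e. one computation
of `∇ψ₀(s, θ)`: the point `z = Forward(s, θ)`, the value `f (s, z) = ψ₀(s, θ)`, the gradient of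
`ψ₀` at `(s, θ)`, and the values and gradients at `(s, z)` of the functions of the problem. -/
structure GradientReply (m n : ℕ) where
  z : Fin n → ℝ
  value : ℝ
  gradPsi : (Fin m → ℝ) × (Fin n → ℝ) →L[ℝ] ℝ
  gradF : (Fin m → ℝ) × (Fin n → ℝ) →L[ℝ] ℝ
  valueMu : Fin n → ℝ
  valueEta : Fin n → ℝ
  gradMu : (i : Fin n) → ((Fin m → ℝ) × (Fin i → ℝ) →L[ℝ] ℝ)
  gradEta : (i : Fin n) → ((Fin m → ℝ) × (Fin i → ℝ) →L[ℝ] ℝ)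

namespace StageProblem

variable {m n : ℕ}

/-- Feasibility for the convex problem. -/
def Feasible (P : StageProblem m n) (S : Set (Fin m → ℝ)) (s : Fin m → ℝ) (z : Fin n → ℝ) : Prop :=
  s ∈ S ∧ ∀ i, P.μ i (s, before i z) ≤ z i ∧ z i ≤ P.η i (s, before i z)

/-- Feasible points can be built inductively: if the constraints before the `i`-th one hold,
then the `i`-th one can be satisfied. -/
def InductivelyFeasible (P : StageProblem m n) (S : Set (Fin m → ℝ)) : Prop :=
  ∀ (i : Fin n) (s : Fin m → ℝ) (z : Fin n → ℝ), s ∈ S →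
    (∀ j < i, P.μ j (s, before j z) ≤ z j ∧ z j ≤ P.η j (s, before j z)) →
    P.μ i (s, before i z) ≤ P.η i (s, before i z)

/-- `z = Forward(s, θ)`, i.e. `z i = (1 - θ i) μ i (s, z_{<i}) + θ i η i (s, z_{<i})`. -/
def forward (P : StageProblem m n) (s : Fin m → ℝ) (θ : Fin n → ℝ) (i : Fin n) : ℝ :=
  (1 - θ i) * P.μ i (s, fun j => forward P s θ ⟨j, j.2.trans i.2⟩) +
    θ i * P.η i (s, fun j => forward P s θ ⟨j, j.2.trans i.2⟩)
termination_by i.val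
decreasing_by all_goals exact j.2

/-- `ψ_k(s, z_{1:k}, θ_{k+1:n})`: `ψ_n = f`, and `ψ_k` arises from `ψ_{k+1}` by substituting
`(1 - θ) μ + θ η` for the last `z` variable. Only the coordinates of `θ` from the `k`-th one on
(counted from `0`) are used. -/
def psi (P : StageProblem m n) (k : ℕ) (s : Fin m → ℝ) (z : Fin k → ℝ) (θ : Fin n → ℝ) : ℝ :=
  if h : k < n then
    psi P (k + 1) s
      (Fin.snoc (α := fun _ => ℝ) z
        ((1 - θ ⟨k, h⟩) * P.μ ⟨k, h⟩ (s, z) + θ ⟨k, h⟩ * P.η ⟨k, h⟩ (s, z))) θ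
  else P.f (s, fun j => z ⟨j, j.2.trans_le (not_lt.mp h)⟩)
termination_by n - k

/-- The objective `ψ₀(s, θ)` of the nonconvex reformulation. -/
def psi0 (P : StageProblem m n) (x : (Fin m → ℝ) × (Fin n → ℝ)) : ℝ :=
  P.psi 0 x.1 Fin.elim0 x.2

/-- The multipliers `y_i = ∂ψ_i/∂z_i` at `(s, z, θ)` with `z = Forward(s, θ)`. -/
def multiplier (P : StageProblem m n) (s : Fin m → ℝ) (θ : Fin n → ℝ) (i : Fin n) : ℝ :=
  deriv (fun t : ℝ =>
    P.psi (i + 1) s (Fin.snoc (α := fun _ => ℝ) (before i (P.forward s θ)) t) θ) (P.forward s θ i)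

/-- The Lagrangian `f + ∑ᵢ (yᵢ⁺ μᵢ - yᵢ⁻ ηᵢ - yᵢ zᵢ)`, with `y⁺ = max y 0`, `y⁻ = max (-y) 0`. -/
def lagrangian (P : StageProblem m n) (y : Fin n → ℝ) (x : (Fin m → ℝ) × (Fin n → ℝ)) : ℝ :=
  P.f x + ∑ i, (max (y i) 0 * P.μ i (x.1, before i x.2)
    - max (-y i) 0 * P.η i (x.1, before i x.2) - y i * x.2 i)

/-- The duality gap `Δ(s, θ)`: with `z = Forward(s, θ)` and `y` the multipliers at `(s, θ)`,
`∑ᵢ (yᵢ zᵢ - yᵢ⁺ μᵢ + yᵢ⁻ ηᵢ) + sup_{(ŝ, ẑ) ∈ S × Z} ∇_{s,z} 𝓛(s, z, y) · (s - ŝ, z - ẑ)`.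
The gradient is relative to the domain `S × ℝⁿ`; its values at the vectors `(s - ŝ, z - ẑ)` are
determined by the function, also where `S` has no interior. -/
def dualityGap (P : StageProblem m n) (S : Set (Fin m → ℝ)) (Z : Set (Fin n → ℝ))
    (s : Fin m → ℝ) (θ : Fin n → ℝ) : ℝ :=
  let z := P.forward s θ
  let y := P.multiplier s θ
  (∑ i, (y i * z i - max (y i) 0 * P.μ i (s, before i z) + max (-y i) 0 * P.η i (s, before i z)))
    + sSup ((fun x => fderivWithin ℝ (P.lagrangian y) (S ×ˢ univ) (s, z) ((s, z) - x)) '' (S ×ˢ Z))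

/-- The outcome of one computation of `∇ψ₀` at the point `x = (s, θ)`. -/
def gradientReply (P : StageProblem m n) (S : Set (Fin m → ℝ))
    (x : (Fin m → ℝ) × (Fin n → ℝ)) : GradientReply m n where
  z := P.forward x.1 x.2
  value := P.f (x.1, P.forward x.1 x.2)
  gradPsi := fderivWithin ℝ P.psi0 (boxDomain n S) x
  gradF := fderivWithin ℝ P.f (S ×ˢ univ) (x.1, P.forward x.1 x.2)
  valueMu := fun i => P.μ i (x.1, before i (P.forward x.1 x.2))
  valueEta := fun i => P.η i (x.1, before i (P.forward x.1 x.2))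
  gradMu := fun i => fderivWithin ℝ (P.μ i) (S ×ˢ univ) (x.1, before i (P.forward x.1 x.2))
  gradEta := fun i => fderivWithin ℝ (P.η i) (S ×ˢ univ) (x.1, before i (P.forward x.1 x.2))

end StageProblem

/-- What a method does next: compute `∇ψ₀` at a point `(s, θ)`, or terminate and return a point. -/
inductive GradientAction (m n : ℕ) where
  | compute (x : (Fin m → ℝ) × (Fin n → ℝ)) : GradientAction m n
  | output (x : (Fin m → ℝ) × (Fin n → ℝ)) : GradientAction m n

/-- A deterministic algorithm that gets the tolerance `ε` as input and learns about the functions of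
the problem only through the computations of `∇ψ₀` that it asks for. -/
structure GradientAlgorithm (m n : ℕ) where
  State : Type
  start : ℝ → State
  action : State → GradientAction m n
  update : State → GradientReply m n → State

namespace GradientAlgorithm

variable {m n : ℕ}

/-- The state after `k` rounds, for the problem `P` over `S` and the input `ε`. A round is one
computation of `∇ψ₀`; an algorithm that has terminated stays in its state. -/
def stateAfter (A : GradientAlgorithm m n) (P : StageProblem m n) (S : Set (Fin m → ℝ)) (ε : ℝ) :
    ℕ → A.State
  | 0 => A.start ε
  | k + 1 =>
    match A.action (A.stateAfter P S ε k) with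
    | .compute x => A.update (A.stateAfter P S ε k) (P.gradientReply S x)
    | .output _ => A.stateAfter P S ε k

/-- The algorithm returns `x` after exactly `N` computations of `∇ψ₀`, all of them at points of
`S × [0,1]ⁿ`. -/
def ReturnsAfter (A : GradientAlgorithm m n) (P : StageProblem m n) (S : Set (Fin m → ℝ)) (ε : ℝ)
    (N : ℕ) (x : (Fin m → ℝ) × (Fin n → ℝ)) : Prop :=
  (∀ k < N, ∃ w ∈ boxDomain n S, A.action (A.stateAfter P S ε k) = .compute w) ∧
    A.action (A.stateAfter P S ε N) = .output x

end GradientAlgorithm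

end

/-! The algorithm minimizes `psi0` over S × [0,1]ⁿ in sweeps: one step for each θᵢ, from the last
index to the first, then a Frank-Wolfe step in s. The core is that, for small step sizes, a sweep
that hardly decreases `psi0` passes through a point with a small duality gap.

The chain rule along the recursion (`gradient_identity`, `lagrangianGrad_eq`) shows that the
gradient of the Lagrangian is the s-gradient of `psi0` plus multiples of ∇μᵢ - ∇ηᵢ, with the weights
rᵢ = θᵢyᵢ⁺ + (1-θᵢ)yᵢ⁻ (`residual`). The complementarity sum is ∑ rᵢ(ηᵢ-μᵢ). So the gap is at most a
constant times ∑ rᵢ plus the Frank-Wolfe gap in s (`dualityGap_le`).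

Stationarity in θ would not suffice: ∂ψ₀/∂θᵢ = yᵢ(ηᵢ-μᵢ) also vanishes where μᵢ = ηᵢ, whatever rᵢ
is. The coordinate steps are therefore measured by the change of zᵢ, at most c|yᵢ|: either θᵢ
reaches the right end, or `psi0` drops by at least c|yᵢ|²/2 (`coordStep_spec`). A later step at a
smaller index leaves θⱼ alone and changes yⱼ only in proportion to its own change of z
(`abs_multiplier_update_sub_le`), which is small if progress is small. Hence the decreasing order
keeps the earlier residuals small.

The smoothness constants are unknown to the algorithm, so sweep k uses the step size 1/(1+√(kε)). It
becomes small enough after O(1/ε) sweeps and stays of order ε for O(ε⁻³) sweeps. As long as the gap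
exceeds ε, each of these sweeps gains order ε·ε², which the boundedness of `psi0` limits
(`exists_sweep_count`, `exists_dualityGap_le`). Convexity of the Lagrangian turns a small gap into
the two lower bounds. -/

/-! ### Calculus with gradients relative to convex sets -/

section SmoothCalculus

variable {E F G : Type*} [NormedAddCommGroup E] [NormedSpace ℝ E] [NormedAddCommGroup F]
  [NormedSpace ℝ F] [NormedAddCommGroup G] [NormedSpace ℝ G]

/-- The vector-valued version of `SmoothOn`. -/
def SmoothMapOn (X : Set E) (h : E → F) : Prop :=
  ∃ g : E → (E →L[ℝ] F), (∀ x ∈ X, HasFDerivWithinAt h (g x) X x) ∧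
    ∀ B ⊆ X, Bornology.IsBounded B → ∃ K : NNReal, LipschitzOnWith K g B

/-- Two derivatives relative to a convex set agree in the directions that point into the set. -/
theorem HasFDerivWithinAt.apply_eq_of_convex {X : Set E} (hX : Convex ℝ X) {h : E → F}
    {A B : E →L[ℝ] F} {x v : E} (hA : HasFDerivWithinAt h A X x)
    (hB : HasFDerivWithinAt h B X x) (hx : x ∈ X) (hv : x + v ∈ X) : A v = B v := by
  have h1 := mem_tangentConeAt_of_segment_subset (hX.segment_subset hx hv)
  rw [add_sub_cancel_left] at h1
  exact hA.unique_on hB h1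

theorem lipschitz_gradient_bounds {X : Set E} (hX : Convex ℝ X) {h : E → F}
    {g : E → (E →L[ℝ] F)} (hg : ∀ x ∈ X, HasFDerivWithinAt h (g x) X x)
    (hL : ∀ B ⊆ X, Bornology.IsBounded B → ∃ K : NNReal, LipschitzOnWith K g B)
    {B : Set E} (hB : B ⊆ X) (hBb : Bornology.IsBounded B) :
    ∃ K : ℝ, 0 ≤ K ∧ (∀ x ∈ B, ‖h x‖ ≤ K) ∧ (∀ x ∈ B, ‖g x‖ ≤ K) ∧
      ∀ x ∈ B, ∀ y ∈ B, ‖g y - g x‖ ≤ K * ‖y - x‖ ∧ ‖h y - h x‖ ≤ K * ‖y - x‖ ∧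
        ‖h y - h x - g x (y - x)‖ ≤ K * ‖y - x‖ ^ 2 := by
  rcases B.eq_empty_or_nonempty with rfl | ⟨x₀, hx₀⟩
  · exact ⟨0, le_rfl, by simp, by simp, by simp⟩
  obtain ⟨R, hR⟩ := hBb.subset_closedBall (0 : E)
  -- B need not be convex; the mean value inequality is applied on this larger set, which is convex
  -- and still bounded.
  set B' := X ∩ Metric.closedBall (0 : E) R with hB'
  have hBB' : B ⊆ B' := subset_inter hB hR
  have hconv : Convex ℝ B' := hX.inter (convex_closedBall _ _)
  obtain ⟨K, hK⟩ := hL B' inter_subset_left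
    (Metric.isBounded_closedBall.subset inter_subset_right)
  have hR0 : 0 ≤ R := by
    have := hR hx₀
    rw [mem_closedBall_zero_iff] at this
    exact (norm_nonneg _).trans this
  have hdiff : ∀ x ∈ B', ∀ y ∈ B', ‖y - x‖ ≤ 2 * R := by
    intro x hx y hy
    have h1 := mem_closedBall_zero_iff.1 hx.2
    have h2 := mem_closedBall_zero_iff.1 hy.2
    linarith [norm_sub_le y x]
  have hgl : ∀ x ∈ B', ∀ y ∈ B', ‖g y - g x‖ ≤ K * ‖y - x‖ := fun x hx y hy =>
    hK.norm_sub_le hy hx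
  set M : ℝ := ‖g x₀‖ + K * (2 * R) with hM
  have hM0 : 0 ≤ M := by positivity
  have hgM : ∀ x ∈ B', ‖g x‖ ≤ M := by
    intro x hx
    have h1 := hgl x₀ (hBB' hx₀) x hx
    have h2 := mul_le_mul_of_nonneg_left (hdiff x₀ (hBB' hx₀) x hx) K.2
    have h3 := norm_le_norm_add_norm_sub' (g x) (g x₀)
    simp only [NNReal.val_eq_coe] at h2
    linarith
  have hder : ∀ x ∈ B', HasFDerivWithinAt h (g x) B' x := fun x hx =>
    (hg x hx.1).mono inter_subset_left
  have hhl : ∀ x ∈ B', ∀ y ∈ B', ‖h y - h x‖ ≤ M * ‖y - x‖ := fun x hx y hy =>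
    hconv.norm_image_sub_le_of_norm_hasFDerivWithin_le hder hgM hx hy
  have htay : ∀ x ∈ B', ∀ y ∈ B', ‖h y - h x - g x (y - x)‖ ≤ K * ‖y - x‖ ^ 2 := by
    intro x hx y hy
    have hseg : segment ℝ x y ⊆ B' := hconv.segment_subset hx hy
    have h1 := (convex_segment x y).norm_image_sub_le_of_norm_hasFDerivWithin_le'
      (f := h) (f' := g) (φ := g x) (C := K * ‖y - x‖)
      (fun z hz => (hder z (hseg hz)).mono hseg)
      (fun z hz => (hgl x hx z (hseg hz)).trans (by
        gcongr
        obtain ⟨a, b, ha, hb, hab, rfl⟩ := hz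
        have : a • x + b • y - x = b • (y - x) := by
          rw [show a = 1 - b by linarith]; module
        rw [this, norm_smul, Real.norm_eq_abs, abs_of_nonneg hb]
        exact mul_le_of_le_one_left (norm_nonneg _) (by linarith)))
      (left_mem_segment ℝ x y) (right_mem_segment ℝ x y)
    calc _ ≤ _ := h1
      _ = _ := by ring
  have hhM : ∀ x ∈ B', ‖h x‖ ≤ ‖h x₀‖ + M * (2 * R) := by
    intro x hx
    have h1 := hhl x₀ (hBB' hx₀) x hx
    have h2 := mul_le_mul_of_nonneg_left (hdiff x₀ (hBB' hx₀) x hx) hM0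
    have h3 := norm_le_norm_add_norm_sub' (h x) (h x₀)
    linarith
  have e1 : 0 ≤ M * (2 * R) := by positivity
  have e2 : (0 : ℝ) ≤ K := K.2
  have e3 : 0 ≤ ‖h x₀‖ := norm_nonneg _
  refine ⟨K + M + (‖h x₀‖ + M * (2 * R)), by linarith, fun x hx => ?_, fun x hx => ?_,
    fun x hx y hy => ⟨?_, ?_, ?_⟩⟩
  · linarith [hhM x (hBB' hx)]
  · linarith [hgM x (hBB' hx)]
  · exact (hgl x (hBB' hx) y (hBB' hy)).trans (by gcongr; linarith)
  · exact (hhl x (hBB' hx) y (hBB' hy)).trans (by gcongr; linarith)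
  · exact (htay x (hBB' hx) y (hBB' hy)).trans (by gcongr; linarith)

/-- Bounds on `B` for the values, derivatives and Taylor remainders of a function on `X`.
The derivatives are tested only in the directions that point into the domain. -/
structure TaylorBound (X B : Set E) (h : E → F) (K : ℝ) : Prop where
  nonneg : 0 ≤ K
  norm_le : ∀ x ∈ B, ‖h x‖ ≤ K
  norm_fderiv_le : ∀ x ∈ B, ∀ v, x + v ∈ X → ‖fderivWithin ℝ h X x v‖ ≤ K * ‖v‖
  norm_sub_le : ∀ x ∈ B, ∀ y ∈ B, ‖h y - h x‖ ≤ K * ‖y - x‖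
  taylor : ∀ x ∈ B, ∀ y ∈ B, ‖h y - h x - fderivWithin ℝ h X x (y - x)‖ ≤ K * ‖y - x‖ ^ 2
  norm_fderiv_sub_le : ∀ x ∈ B, ∀ y ∈ B, ∀ v, x + v ∈ X → y + v ∈ X →
    ‖fderivWithin ℝ h X y v - fderivWithin ℝ h X x v‖ ≤ K * ‖y - x‖ * ‖v‖

theorem TaylorBound.mono {X B : Set E} {h : E → F} {K K' : ℝ} (H : TaylorBound X B h K)
    (hK : K ≤ K') : TaylorBound X B h K' where
  nonneg := H.nonneg.trans hK
  norm_le x hx := (H.norm_le x hx).trans hK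
  norm_fderiv_le x hx v hv := (H.norm_fderiv_le x hx v hv).trans (by gcongr)
  norm_sub_le x hx y hy := (H.norm_sub_le x hx y hy).trans (by gcongr)
  taylor x hx y hy := (H.taylor x hx y hy).trans (by gcongr)
  norm_fderiv_sub_le x hx y hy v h1 h2 :=
    (H.norm_fderiv_sub_le x hx y hy v h1 h2).trans (by gcongr)

theorem SmoothMapOn.exists_taylorBound {X : Set E} (hX : Convex ℝ X) {h : E → F}
    (hh : SmoothMapOn X h) {B : Set E} (hB : B ⊆ X) (hBb : Bornology.IsBounded B) :
    ∃ K : ℝ, TaylorBound X B h K := by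
  obtain ⟨g, hg, hL⟩ := hh
  obtain ⟨K, hK0, h1, h2, h3⟩ := lipschitz_gradient_bounds hX hg hL hB hBb
  have key : ∀ x ∈ X, ∀ v, x + v ∈ X → fderivWithin ℝ h X x v = g x v := fun x hx v hv =>
    (hg x hx).differentiableWithinAt.hasFDerivWithinAt.apply_eq_of_convex hX (hg x hx) hx hv
  refine ⟨K, hK0, h1, fun x hx v hv => ?_, fun x hx y hy => (h3 x hx y hy).2.1,
    fun x hx y hy => ?_, fun x hx y hy v hxv hyv => ?_⟩
  · rw [key x (hB hx) v hv]
    exact (g x).le_of_opNorm_le (h2 x hx) v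
  · rw [key x (hB hx) _ (by rw [add_sub_cancel]; exact hB hy)]
    exact (h3 x hx y hy).2.2
  · rw [key x (hB hx) v hxv, key y (hB hy) v hyv, ← sub_apply]
    exact (g y - g x).le_of_opNorm_le (h3 x hx y hy).1 v

theorem SmoothMapOn.hasFDerivWithinAt {X : Set E} {h : E → F} (hh : SmoothMapOn X h) {x : E}
    (hx : x ∈ X) : HasFDerivWithinAt h (fderivWithin ℝ h X x) X x := by
  obtain ⟨g, hg, -⟩ := hh
  exact (hg x hx).differentiableWithinAt.hasFDerivWithinAt

theorem smoothMapOn_of_exists_bound {X : Set E} {h : E → F} (g : E → (E →L[ℝ] F))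
    (hg : ∀ x ∈ X, HasFDerivWithinAt h (g x) X x)
    (hL : ∀ B ⊆ X, Bornology.IsBounded B →
      ∃ K : ℝ, 0 ≤ K ∧ ∀ x ∈ B, ∀ y ∈ B, ‖g y - g x‖ ≤ K * ‖y - x‖) : SmoothMapOn X h := by
  refine ⟨g, hg, fun B hB hBb => ?_⟩
  obtain ⟨K, hK0, hK⟩ := hL B hB hBb
  refine ⟨⟨K, hK0⟩, LipschitzOnWith.of_dist_le_mul fun x hx y hy => ?_⟩
  rw [dist_eq_norm, dist_eq_norm]
  exact hK y hy x hx

theorem ContinuousLinearMap.smoothMapOn (A : E →L[ℝ] F) (X : Set E) : SmoothMapOn X A :=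
  smoothMapOn_of_exists_bound (fun _ => A) (fun _ _ => A.hasFDerivWithinAt)
    fun _ _ _ => ⟨0, le_rfl, by simp⟩

theorem smoothMapOn_const (c : F) (X : Set E) : SmoothMapOn X fun _ : E => c :=
  smoothMapOn_of_exists_bound (fun _ => 0) (fun _ _ => hasFDerivWithinAt_const _ _ _)
    fun _ _ _ => ⟨0, le_rfl, by simp⟩

theorem SmoothMapOn.prodMk {X : Set E} (hX : Convex ℝ X) {h : E → F} {k : E → G}
    (hh : SmoothMapOn X h) (hk : SmoothMapOn X k) : SmoothMapOn X fun x => (h x, k x) := by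
  obtain ⟨g₁, hg₁, hL₁⟩ := hh
  obtain ⟨g₂, hg₂, hL₂⟩ := hk
  refine smoothMapOn_of_exists_bound (fun x => (g₁ x).prod (g₂ x))
    (fun x hx => (hg₁ x hx).prodMk (hg₂ x hx)) fun B hB hBb => ?_
  obtain ⟨K₁, h0, -, -, h1⟩ := lipschitz_gradient_bounds hX hg₁ hL₁ hB hBb
  obtain ⟨K₂, h0', -, -, h2⟩ := lipschitz_gradient_bounds hX hg₂ hL₂ hB hBb
  refine ⟨max K₁ K₂, le_max_of_le_left h0, fun x hx y hy => ?_⟩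
  refine ContinuousLinearMap.opNorm_le_bound _ (by positivity) fun v => ?_
  refine max_le ?_ ?_
  · refine ((g₁ y - g₁ x).le_of_opNorm_le (h1 x hx y hy).1 v).trans ?_
    gcongr; exact le_max_left _ _
  · refine ((g₂ y - g₂ x).le_of_opNorm_le (h2 x hx y hy).1 v).trans ?_
    gcongr; exact le_max_right _ _

theorem SmoothMapOn.comp {X : Set E} {Y : Set F} (hX : Convex ℝ X) (hY : Convex ℝ Y)
    {h : E → F} {k : F → G} (hk : SmoothMapOn Y k) (hh : SmoothMapOn X h) (hXY : MapsTo h X Y) :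
    SmoothMapOn X (k ∘ h) := by
  obtain ⟨g₁, hg₁, hL₁⟩ := hh
  obtain ⟨g₂, hg₂, hL₂⟩ := hk
  refine smoothMapOn_of_exists_bound (fun x => (g₂ (h x)).comp (g₁ x))
    (fun x hx => (hg₂ _ (hXY hx)).comp x (hg₁ x hx) hXY) fun B hB hBb => ?_
  obtain ⟨K₁, hK₁, hb₁, hn₁, h1⟩ := lipschitz_gradient_bounds hX hg₁ hL₁ hB hBb
  have himg : Bornology.IsBounded (h '' B) :=
    isBounded_iff_forall_norm_le.2 ⟨K₁, by rintro _ ⟨x, hx, rfl⟩; exact hb₁ x hx⟩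
  obtain ⟨K₂, hK₂, -, hn₂, h2⟩ := lipschitz_gradient_bounds hY hg₂ hL₂
    (B := h '' B) (by rintro _ ⟨x, hx, rfl⟩; exact hXY (hB hx)) himg
  refine ⟨K₂ * K₁ * K₁ + K₂ * K₁, by positivity, fun x hx y hy => ?_⟩
  have e : (g₂ (h y)).comp (g₁ y) - (g₂ (h x)).comp (g₁ x) =
      (g₂ (h y) - g₂ (h x)).comp (g₁ y) + (g₂ (h x)).comp (g₁ y - g₁ x) := by
    ext v; simp
  obtain ⟨a1, a2, -⟩ := h1 x hx y hy
  obtain ⟨b1, -⟩ := h2 _ (mem_image_of_mem h hx) _ (mem_image_of_mem h hy)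
  rw [e]
  calc _ ≤ ‖g₂ (h y) - g₂ (h x)‖ * ‖g₁ y‖ + ‖g₂ (h x)‖ * ‖g₁ y - g₁ x‖ :=
        (norm_add_le _ _).trans (add_le_add (ContinuousLinearMap.opNorm_comp_le _ _)
          (ContinuousLinearMap.opNorm_comp_le _ _))
    _ ≤ K₂ * (K₁ * ‖y - x‖) * K₁ + K₂ * (K₁ * ‖y - x‖) := by
        gcongr
        · exact b1.trans (by gcongr)
        · exact hn₁ y hy
        · exact hn₂ _ (mem_image_of_mem h hx)
    _ = _ := by ring

theorem smoothMapOn_mul : SmoothMapOn (univ : Set (ℝ × ℝ)) fun p : ℝ × ℝ => p.1 * p.2 := by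
  refine smoothMapOn_of_exists_bound (fun p => p.1 • ContinuousLinearMap.snd ℝ ℝ ℝ +
    p.2 • ContinuousLinearMap.fst ℝ ℝ ℝ) (fun p _ => ?_) fun B _ _ => ⟨2, by norm_num, ?_⟩
  · exact (hasFDerivAt_fst.mul hasFDerivAt_snd).hasFDerivWithinAt
  · intro x _ y _
    refine ContinuousLinearMap.opNorm_le_bound _ (by positivity) fun v => ?_
    have e : (y.1 • ContinuousLinearMap.snd ℝ ℝ ℝ + y.2 • ContinuousLinearMap.fst ℝ ℝ ℝ -
        (x.1 • ContinuousLinearMap.snd ℝ ℝ ℝ + x.2 • ContinuousLinearMap.fst ℝ ℝ ℝ)) v =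
        (y - x).1 * v.2 + (y - x).2 * v.1 := by
      simp; ring
    rw [e]
    calc _ ≤ ‖(y - x).1‖ * ‖v.2‖ + ‖(y - x).2‖ * ‖v.1‖ := by
          refine (norm_add_le _ _).trans ?_
          rw [norm_mul, norm_mul]
      _ ≤ ‖y - x‖ * ‖v‖ + ‖y - x‖ * ‖v‖ := by
          gcongr
          exacts [norm_fst_le _, norm_snd_le _, norm_snd_le _, norm_fst_le _]
      _ = _ := by ring

theorem SmoothMapOn.mul {X : Set E} (hX : Convex ℝ X) {h k : E → ℝ} (hh : SmoothMapOn X h)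
    (hk : SmoothMapOn X k) : SmoothMapOn X fun x => h x * k x :=
  smoothMapOn_mul.comp hX convex_univ (hh.prodMk hX hk) fun _ _ => mem_univ _

theorem SmoothMapOn.add {X : Set E} (hX : Convex ℝ X) {h k : E → F} (hh : SmoothMapOn X h)
    (hk : SmoothMapOn X k) : SmoothMapOn X fun x => h x + k x :=
  SmoothMapOn.comp hX convex_univ
    ((ContinuousLinearMap.fst ℝ F F + ContinuousLinearMap.snd ℝ F F).smoothMapOn univ)
    (hh.prodMk hX hk) fun _ _ => mem_univ _

/-- A convex function lies above its linearizations, also relative to a set without interior. -/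
theorem ConvexOn.add_fderiv_le {X : Set E} {h : E → ℝ} (hh : ConvexOn ℝ X h) {A : E →L[ℝ] ℝ}
    {x y : E} (hx : x ∈ X) (hy : y ∈ X) (hA : HasFDerivWithinAt h A X x) :
    h x + A (y - x) ≤ h y := by
  have hline : HasDerivWithinAt (fun t : ℝ => h (AffineMap.lineMap x y t)) (A (y - x))
      (Icc 0 1) 0 := by
    have h1 : HasDerivWithinAt (fun t : ℝ => AffineMap.lineMap x y t) (y - x)
        (Icc (0 : ℝ) 1) 0 := AffineMap.hasDerivWithinAt_lineMap
    have h2 : HasFDerivWithinAt h A X (AffineMap.lineMap x y (0 : ℝ)) := by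
      rwa [AffineMap.lineMap_apply_zero]
    exact h2.comp_hasDerivWithinAt (0 : ℝ) h1
      fun t ht => hh.1.lineMap_mem hx hy ht
  have hc : ConvexOn ℝ (Icc (0 : ℝ) 1) (fun t : ℝ => h (AffineMap.lineMap x y t)) :=
    (hh.comp_affineMap (AffineMap.lineMap x y)).subset
      (fun t ht => hh.1.lineMap_mem hx hy ht) (convex_Icc 0 1)
  have := hc.le_slope_of_hasDerivWithinAt (x := 0) (y := 1) (by simp) (by simp) zero_lt_one hline
  rw [slope_def_field] at this
  simp only [AffineMap.lineMap_apply_one, AffineMap.lineMap_apply_zero, sub_zero, div_one] at this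
  linarith

end SmoothCalculus

/-! ### Initial segments of coordinate vectors, and domains -/

/-- Appending a coordinate, as a continuous linear map. -/
noncomputable def snocCLM (k : ℕ) : ((Fin k → ℝ) × ℝ) →L[ℝ] (Fin (k + 1) → ℝ) :=
  LinearMap.toContinuousLinearMap
    { toFun := fun p => Fin.snoc (α := fun _ => ℝ) p.1 p.2
      map_add' := fun p q => by
        ext j; refine Fin.lastCases ?_ (fun j => ?_) j <;> simp
      map_smul' := fun c p => by
        ext j; refine Fin.lastCases ?_ (fun j => ?_) j <;> simp }

@[simp]
theorem snocCLM_apply (k : ℕ) (p : (Fin k → ℝ) × ℝ) :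
    snocCLM k p = Fin.snoc (α := fun _ => ℝ) p.1 p.2 := rfl

/-- The first `k` coordinates of `z`. -/
def initial {n : ℕ} (k : ℕ) (hk : k ≤ n) (z : Fin n → ℝ) : Fin k → ℝ :=
  fun j => z ⟨j, j.2.trans_le hk⟩

theorem initial_val {n : ℕ} (i : Fin n) (z : Fin n → ℝ) : initial i i.2.le z = before i z := rfl

theorem initial_self {n : ℕ} (z : Fin n → ℝ) : initial n le_rfl z = z := rfl

theorem initial_succ {n : ℕ} (i : Fin n) (z : Fin n → ℝ) :
    initial (i + 1) i.2 z = Fin.snoc (α := fun _ => ℝ) (before i z) (z i) := by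
  ext j
  refine Fin.lastCases ?_ (fun j => ?_) j <;> simp [initial, before]

theorem norm_initial_le {n : ℕ} (k : ℕ) (hk : k ≤ n) (z : Fin n → ℝ) : ‖initial k hk z‖ ≤ ‖z‖ :=
  (pi_norm_le_iff_of_nonneg (norm_nonneg _)).2 fun _ => norm_le_pi_norm z _

/-- A telescoping sum whose terms may live in types depending on k; `gradient_identity` applies it
to the derivatives of ψ₀, …, ψₙ. -/
theorem sum_fin_eq_sub_of_succ {n : ℕ} (a : (k : ℕ) → k ≤ n → ℝ) (b : Fin n → ℝ)
    (h : ∀ i : Fin n, a (i + 1) i.2 = a i i.2.le + b i) :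
    a n le_rfl = a 0 n.zero_le + ∑ i, b i := by
  have key : ∀ k (hk : k ≤ n), a k hk =
      a 0 n.zero_le + ∑ i ∈ Finset.range k, if h : i < n then b ⟨i, h⟩ else 0 := by
    intro k
    induction k with
    | zero => intro _; simp
    | succ k ih =>
      intro hk
      rw [Finset.sum_range_succ, ← add_assoc, ← ih (by omega),
        dif_pos (Nat.lt_of_succ_le hk)]
      exact h ⟨k, hk⟩
  rw [key n le_rfl, ← Fin.sum_univ_eq_sum_range (fun i => if h : i < n then b ⟨i, h⟩ else 0)]
  simp

/-- The domain of the functions `ψ_k`. -/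
def psiDomain {m : ℕ} (n k : ℕ) (S : Set (Fin m → ℝ)) :
    Set ((Fin m → ℝ) × (Fin k → ℝ) × (Fin n → ℝ)) :=
  S ×ˢ (univ ×ˢ Icc 0 1)

theorem convex_psiDomain {m : ℕ} (n k : ℕ) {S : Set (Fin m → ℝ)} (hS : Convex ℝ S) :
    Convex ℝ (psiDomain n k S) :=
  hS.prod (convex_univ.prod (convex_Icc _ _))

theorem convex_boxDomain {m : ℕ} (n : ℕ) {S : Set (Fin m → ℝ)} (hS : Convex ℝ S) :
    Convex ℝ (boxDomain n S) :=
  hS.prod (convex_Icc _ _)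

/-! ### The recursions for Forward and ψ -/

namespace StageProblem

variable {m n : ℕ}

/-- The value of the `i`-th coordinate that belongs to given values of the coordinates before. -/
noncomputable def stageValue (P : StageProblem m n) (i : Fin n)
    (x : (Fin m → ℝ) × (Fin i → ℝ) × (Fin n → ℝ)) : ℝ :=
  (1 - x.2.2 i) * P.μ i (x.1, x.2.1) + x.2.2 i * P.η i (x.1, x.2.1)

theorem forward_eq (P : StageProblem m n) (s : Fin m → ℝ) (θ : Fin n → ℝ) (i : Fin n) :
    P.forward s θ i = P.stageValue i (s, before i (P.forward s θ), θ) := by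
  rw [forward]; rfl

theorem psi_val (P : StageProblem m n) (i : Fin n) (s : Fin m → ℝ) (z : Fin i → ℝ)
    (θ : Fin n → ℝ) : P.psi i s z θ =
      P.psi (i + 1) s (Fin.snoc (α := fun _ => ℝ) z (P.stageValue i (s, z, θ))) θ := by
  rw [psi, dif_pos i.2]; rfl

theorem psi_last (P : StageProblem m n) (s : Fin m → ℝ) (z : Fin n → ℝ) (θ : Fin n → ℝ) :
    P.psi n s z θ = P.f (s, z) := by
  rw [psi, dif_neg (lt_irrefl n)]

theorem psi_initial_forward (P : StageProblem m n) (s : Fin m → ℝ) (θ : Fin n → ℝ) (k : ℕ)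
    (hk : k ≤ n) : P.psi k s (initial k hk (P.forward s θ)) θ = P.psi0 (s, θ) := by
  induction k with
  | zero => rw [psi0]; congr 1; exact Subsingleton.elim _ _
  | succ k ih =>
    rw [← ih (by omega)]
    have := P.psi_val ⟨k, hk⟩ s (initial k (by omega) (P.forward s θ)) θ
    rw [this]
    congr 1
    rw [initial_succ ⟨k, hk⟩, forward_eq]
    rfl

/-- Because of this, a change of θᵢ acts on ψ_{i+1} only through the z variables. -/
theorem psi_congr (P : StageProblem m n) {θ θ' : Fin n → ℝ} (k : ℕ) (hk : k ≤ n)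
    (h : ∀ j : Fin n, k ≤ j → θ j = θ' j) (s : Fin m → ℝ) (z : Fin k → ℝ) :
    P.psi k s z θ = P.psi k s z θ' := by
  induction hk using Nat.decreasingInduction with
  | self => rw [psi_last, psi_last]
  | of_succ k hk ih =>
    have e1 := P.psi_val ⟨k, hk⟩ s z θ
    have e2 := P.psi_val ⟨k, hk⟩ s z θ'
    simp only at e1 e2
    rw [e1, e2, ih fun j hj => h j (by omega)]
    simp only [stageValue, h ⟨k, hk⟩ le_rfl]

end StageProblem

/-! ### Smoothness of ψ and the chain rule for the multipliers -/

namespace StageProblem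

variable {m n : ℕ}

/-- The hypotheses on a stagewise convex problem over `S`, with `Z` a bound for its solutions. -/
structure Admissible (P : StageProblem m n) (S : Set (Fin m → ℝ)) (Z : Set (Fin n → ℝ)) :
    Prop where
  nonempty : S.Nonempty
  convex : Convex ℝ S
  bounded : Bornology.IsBounded S
  boundedZ : Bornology.IsBounded Z
  convex_f : ConvexOn ℝ (S ×ˢ univ) P.f
  convex_mu : ∀ i, ConvexOn ℝ (S ×ˢ univ) (P.μ i)
  concave_eta : ∀ i, ConcaveOn ℝ (S ×ˢ univ) (P.η i)
  smooth_f : SmoothMapOn (S ×ˢ univ) P.f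
  smooth_mu : ∀ i, SmoothMapOn (S ×ˢ univ) (P.μ i)
  smooth_eta : ∀ i, SmoothMapOn (S ×ˢ univ) (P.η i)
  mem_of_feasible : ∀ s z, P.Feasible S s z → z ∈ Z
  inductivelyFeasible : P.InductivelyFeasible S

/-- `ψ_k` as a function on its domain. -/
def psiMap (P : StageProblem m n) (k : ℕ) (x : (Fin m → ℝ) × (Fin k → ℝ) × (Fin n → ℝ)) : ℝ :=
  P.psi k x.1 x.2.1 x.2.2

/-- Appending the value of the next coordinate. -/
noncomputable def extend (P : StageProblem m n) (i : Fin n)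
    (x : (Fin m → ℝ) × (Fin i → ℝ) × (Fin n → ℝ)) :
    (Fin m → ℝ) × (Fin (i + 1) → ℝ) × (Fin n → ℝ) :=
  (x.1, Fin.snoc (α := fun _ => ℝ) x.2.1 (P.stageValue i x), x.2.2)

theorem psiMap_val (P : StageProblem m n) (i : Fin n) :
    P.psiMap i = P.psiMap (i + 1) ∘ P.extend i := by
  ext x; exact P.psi_val i _ _ _

/-- The gradient of the `i`-th coordinate as a function of `s` and the coordinates before. -/
noncomputable def stageGrad (P : StageProblem m n) (S : Set (Fin m → ℝ)) (i : Fin n)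
    (x : (Fin m → ℝ) × (Fin i → ℝ)) (t : ℝ) : (Fin m → ℝ) × (Fin i → ℝ) →L[ℝ] ℝ :=
  (1 - t) • fderivWithin ℝ (P.μ i) (S ×ˢ univ) x + t • fderivWithin ℝ (P.η i) (S ×ˢ univ) x

namespace Admissible

variable {P : StageProblem m n} {S : Set (Fin m → ℝ)} {Z : Set (Fin n → ℝ)}

theorem smooth_stageValue (hP : P.Admissible S Z) (i : Fin n) :
    SmoothMapOn (psiDomain n i S) (P.stageValue i) := by
  have hX := convex_psiDomain n i hP.convex
  have hY : Convex ℝ (S ×ˢ (univ : Set (Fin i → ℝ))) := hP.convex.prod convex_univ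
  let pr : (Fin m → ℝ) × (Fin i → ℝ) × (Fin n → ℝ) →L[ℝ] (Fin m → ℝ) × (Fin i → ℝ) :=
    (ContinuousLinearMap.fst ℝ _ _).prod
      ((ContinuousLinearMap.fst ℝ _ _).comp (ContinuousLinearMap.snd ℝ _ _))
  let co : (Fin m → ℝ) × (Fin i → ℝ) × (Fin n → ℝ) →L[ℝ] ℝ :=
    (ContinuousLinearMap.proj i).comp
      ((ContinuousLinearMap.snd ℝ _ _).comp (ContinuousLinearMap.snd ℝ _ _))
  have hpr : MapsTo pr (psiDomain n i S) (S ×ˢ univ) := fun x hx => ⟨hx.1, mem_univ _⟩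
  have h1 := (hP.smooth_mu i).comp hX hY (pr.smoothMapOn _) hpr
  have h2 := (hP.smooth_eta i).comp hX hY (pr.smoothMapOn _) hpr
  have h3 : SmoothMapOn (psiDomain n i S) fun x => 1 + (-co) x :=
    (smoothMapOn_const 1 _).add hX ((-co).smoothMapOn _)
  have h4 := (h3.mul hX h1).add hX ((co.smoothMapOn _).mul hX h2)
  convert h4 using 1
  ext x
  simp [stageValue, pr, co, sub_eq_add_neg]

theorem smooth_extend (hP : P.Admissible S Z) (i : Fin n) :
    SmoothMapOn (psiDomain n i S) (P.extend i) := by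
  have hX := convex_psiDomain n i hP.convex
  let p2 : (Fin m → ℝ) × (Fin i → ℝ) × (Fin n → ℝ) →L[ℝ] (Fin i → ℝ) :=
    (ContinuousLinearMap.fst ℝ _ _).comp (ContinuousLinearMap.snd ℝ _ _)
  let p3 : (Fin m → ℝ) × (Fin i → ℝ) × (Fin n → ℝ) →L[ℝ] (Fin n → ℝ) :=
    (ContinuousLinearMap.snd ℝ _ _).comp (ContinuousLinearMap.snd ℝ _ _)
  exact ((ContinuousLinearMap.fst ℝ _ _).smoothMapOn _).prodMk hX
    ((SmoothMapOn.comp hX convex_univ ((snocCLM i).smoothMapOn univ)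
      ((p2.smoothMapOn _).prodMk hX (hP.smooth_stageValue i)) fun _ _ => mem_univ _).prodMk hX
      (p3.smoothMapOn _))

theorem mapsTo_extend (i : Fin n) :
    MapsTo (P.extend i) (psiDomain n i S) (psiDomain n (i + 1) S) :=
  fun _ hx => ⟨hx.1, mem_univ _, hx.2.2⟩

theorem smooth_psiMap (hP : P.Admissible S Z) (k : ℕ) (hk : k ≤ n) :
    SmoothMapOn (psiDomain n k S) (P.psiMap k) := by
  induction hk using Nat.decreasingInduction with
  | self =>
    let pr : (Fin m → ℝ) × (Fin n → ℝ) × (Fin n → ℝ) →L[ℝ] (Fin m → ℝ) × (Fin n → ℝ) :=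
      (ContinuousLinearMap.fst ℝ _ _).prod
        ((ContinuousLinearMap.fst ℝ _ _).comp (ContinuousLinearMap.snd ℝ _ _))
    have h := hP.smooth_f.comp (convex_psiDomain n n hP.convex) (hP.convex.prod convex_univ)
      (pr.smoothMapOn (psiDomain n n S)) fun x hx => ⟨hx.1, mem_univ _⟩
    convert h using 1
    ext x
    exact P.psi_last _ _ _
  | of_succ k hk ih =>
    have h := SmoothMapOn.comp (convex_psiDomain n k hP.convex)
      (convex_psiDomain n (k + 1) hP.convex)
      ih (hP.smooth_extend ⟨k, hk⟩) (mapsTo_extend ⟨k, hk⟩)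
    rwa [← psiMap_val P ⟨k, hk⟩] at h

theorem add_mem_psiDomain {k : ℕ} {x : (Fin m → ℝ) × (Fin k → ℝ) × (Fin n → ℝ)} {v : Fin m → ℝ}
    (hx : x ∈ psiDomain n k S) (hv : x.1 + v ∈ S) (w : Fin k → ℝ) :
    x + (v, w, 0) ∈ psiDomain n k S := by
  refine ⟨hv, mem_univ _, ?_⟩
  simpa using hx.2.2

/-- The chain rule for one substitution. Since θ is held fixed, the new coordinate moves by the
convex combination `stageGrad` of the two gradients. Only directions that stay in S are tested, as S
may lack interior. -/
theorem fderivWithin_psiMap_val (hP : P.Admissible S Z) (i : Fin n)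
    {x : (Fin m → ℝ) × (Fin i → ℝ) × (Fin n → ℝ)} (hx : x ∈ psiDomain n i S) {v : Fin m → ℝ}
    (hv : x.1 + v ∈ S) (w : Fin i → ℝ) :
    fderivWithin ℝ (P.psiMap i) (psiDomain n i S) x (v, w, 0) =
      fderivWithin ℝ (P.psiMap (i + 1)) (psiDomain n (i + 1) S) (P.extend i x)
        (v, Fin.snoc (α := fun _ => ℝ) w (P.stageGrad S i (x.1, x.2.1) (x.2.2 i) (v, w)), 0) := by
  let pr : (Fin m → ℝ) × (Fin i → ℝ) × (Fin n → ℝ) →L[ℝ] (Fin m → ℝ) × (Fin i → ℝ) :=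
    (ContinuousLinearMap.fst ℝ _ _).prod
      ((ContinuousLinearMap.fst ℝ _ _).comp (ContinuousLinearMap.snd ℝ _ _))
  let co : (Fin m → ℝ) × (Fin i → ℝ) × (Fin n → ℝ) →L[ℝ] ℝ :=
    (ContinuousLinearMap.proj i).comp
      ((ContinuousLinearMap.snd ℝ _ _).comp (ContinuousLinearMap.snd ℝ _ _))
  let p2 : (Fin m → ℝ) × (Fin i → ℝ) × (Fin n → ℝ) →L[ℝ] (Fin i → ℝ) :=
    (ContinuousLinearMap.fst ℝ _ _).comp (ContinuousLinearMap.snd ℝ _ _)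
  let p3 : (Fin m → ℝ) × (Fin i → ℝ) × (Fin n → ℝ) →L[ℝ] (Fin n → ℝ) :=
    (ContinuousLinearMap.snd ℝ _ _).comp (ContinuousLinearMap.snd ℝ _ _)
  have hpr : MapsTo pr (psiDomain n i S) (S ×ˢ univ) := fun x hx => ⟨hx.1, mem_univ _⟩
  have h1 := ((hP.smooth_mu i).hasFDerivWithinAt (hpr hx)).comp x
    (pr.hasFDerivWithinAt (s := psiDomain n i S)) hpr
  have h2 := ((hP.smooth_eta i).hasFDerivWithinAt (hpr hx)).comp x
    (pr.hasFDerivWithinAt (s := psiDomain n i S)) hpr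
  have hco := co.hasFDerivWithinAt (x := x) (s := psiDomain n i S)
  have h3 : HasFDerivWithinAt (P.stageValue i) _ (psiDomain n i S) x :=
    ((hco.const_sub 1).mul h1).add (hco.mul h2)
  have h3' := (snocCLM i).hasFDerivAt.comp_hasFDerivWithinAt x (p2.hasFDerivWithinAt.prodMk h3)
  have h4 : HasFDerivWithinAt (P.extend i) _ (psiDomain n i S) x :=
    (ContinuousLinearMap.fst ℝ (Fin m → ℝ) ((Fin i → ℝ) × (Fin n → ℝ))).hasFDerivWithinAt.prodMk
      (h3'.prodMk p3.hasFDerivWithinAt)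
  have h5 := ((hP.smooth_psiMap (i + 1) i.2).hasFDerivWithinAt
    (mapsTo_extend (P := P) i hx)).comp x h4 (mapsTo_extend (P := P) i)
  rw [← psiMap_val] at h5
  rw [((hP.smooth_psiMap i i.2.le).hasFDerivWithinAt hx).apply_eq_of_convex
    (convex_psiDomain n i hP.convex) h5 hx (add_mem_psiDomain hx hv w)]
  simp [pr, co, p2, p3, stageGrad]

theorem mem_psiDomain {s : Fin m → ℝ} {θ : Fin n → ℝ} (hx : (s, θ) ∈ boxDomain n S) (k : ℕ)
    (z : Fin k → ℝ) : (s, z, θ) ∈ psiDomain n k S :=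
  ⟨hx.1, mem_univ _, hx.2⟩

/-- The partial derivative of `ψ_{i+1}` in its last `z` variable. -/
theorem hasDerivAt_psi_snoc (hP : P.Admissible S Z) (i : Fin n) {s : Fin m → ℝ}
    {θ : Fin n → ℝ} (hx : (s, θ) ∈ boxDomain n S) (z : Fin i → ℝ) (t : ℝ) :
    HasDerivAt (fun t : ℝ => P.psi (i + 1) s (Fin.snoc (α := fun _ => ℝ) z t) θ)
      (fderivWithin ℝ (P.psiMap (i + 1)) (psiDomain n (i + 1) S)
        (s, Fin.snoc (α := fun _ => ℝ) z t, θ) (0, Fin.snoc (α := fun _ => ℝ) 0 1, 0)) t := by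
  have h1 : HasDerivAt (fun t : ℝ => (s, snocCLM i (z, t), θ))
      ((0 : Fin m → ℝ), snocCLM i (0, 1), (0 : Fin n → ℝ)) t :=
    (hasDerivAt_const t s).prodMk
      (((snocCLM i).hasFDerivAt.comp_hasDerivAt t
        ((hasDerivAt_const t z).prodMk (hasDerivAt_id t))).prodMk (hasDerivAt_const t θ))
  have h2 := ((hP.smooth_psiMap (i + 1) i.2).hasFDerivWithinAt
    (mem_psiDomain hx (i + 1) (Fin.snoc (α := fun _ => ℝ) z t))).comp_hasDerivWithinAt
      (s := univ) t h1.hasDerivWithinAt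
      (fun t _ => mem_psiDomain hx (i + 1) (Fin.snoc (α := fun _ => ℝ) z t))
  exact h2.hasDerivAt Filter.univ_mem

theorem multiplier_eq (hP : P.Admissible S Z) (i : Fin n) {s : Fin m → ℝ}
    {θ : Fin n → ℝ} (hx : (s, θ) ∈ boxDomain n S) :
    P.multiplier s θ i = fderivWithin ℝ (P.psiMap (i + 1)) (psiDomain n (i + 1) S)
      (s, initial (i + 1) i.2 (P.forward s θ), θ) (0, Fin.snoc (α := fun _ => ℝ) 0 1, 0) := by
  rw [multiplier, (hP.hasDerivAt_psi_snoc i hx _ _).deriv, ← initial_succ]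

theorem extend_initial (P : StageProblem m n) (i : Fin n) (s : Fin m → ℝ) (θ : Fin n → ℝ) :
    P.extend i (s, before i (P.forward s θ), θ) =
      (s, initial (i + 1) i.2 (P.forward s θ), θ) := by
  rw [extend, initial_succ, ← forward_eq]

/-- The part of the gradient of `ψ₀` with respect to `s`. -/
theorem fderivWithin_psi0 (hP : P.Admissible S Z) {s v : Fin m → ℝ} {θ : Fin n → ℝ}
    (hx : (s, θ) ∈ boxDomain n S) (hv : s + v ∈ S) (z w : Fin 0 → ℝ) :
    fderivWithin ℝ P.psi0 (boxDomain n S) (s, θ) (v, 0) =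
      fderivWithin ℝ (P.psiMap 0) (psiDomain n 0 S) (s, z, θ) (v, w, 0) := by
  let e : (Fin m → ℝ) × (Fin n → ℝ) →L[ℝ] (Fin m → ℝ) × (Fin 0 → ℝ) × (Fin n → ℝ) :=
    (ContinuousLinearMap.fst ℝ _ _).prod
      ((0 : _ →L[ℝ] (Fin 0 → ℝ)).prod (ContinuousLinearMap.snd ℝ _ _))
  have he : MapsTo e (boxDomain n S) (psiDomain n 0 S) := fun x hx => ⟨hx.1, mem_univ _, hx.2⟩
  have hz : z = 0 := Subsingleton.elim _ _
  have hw : w = 0 := Subsingleton.elim _ _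
  subst hz hw
  have h1 := ((hP.smooth_psiMap 0 n.zero_le).hasFDerivWithinAt (he hx)).comp (s, θ)
    (e.hasFDerivWithinAt (s := boxDomain n S)) he
  have h2 : P.psiMap 0 ∘ e = P.psi0 := by
    ext x
    simp only [psi0, psiMap, Function.comp]
    congr 1
    exact Subsingleton.elim _ _
  rw [h2] at h1
  rw [h1.differentiableWithinAt.hasFDerivWithinAt.apply_eq_of_convex
    (convex_boxDomain n hP.convex) h1 hx (v := (v, 0)) ⟨hv, by simpa using hx.2⟩]
  rfl

/-- The gradient of the objective, expressed by the gradient of `ψ₀` and the multipliers. -/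
theorem gradient_identity (hP : P.Admissible S Z) {s v : Fin m → ℝ} {θ : Fin n → ℝ}
    (hx : (s, θ) ∈ boxDomain n S) (hv : s + v ∈ S) (w : Fin n → ℝ) :
    fderivWithin ℝ P.f (S ×ˢ univ) (s, P.forward s θ) (v, w) =
      fderivWithin ℝ P.psi0 (boxDomain n S) (s, θ) (v, 0) +
        ∑ i, P.multiplier s θ i *
          (w i - P.stageGrad S i (s, before i (P.forward s θ)) (θ i) (v, before i w)) := by
  -- Telescoping in k: passing from ψᵢ to ψ_{i+1} replaces the linearized value of the i-th
  -- coordinate by the free component wᵢ, which costs yᵢ times their difference.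
  have h := sum_fin_eq_sub_of_succ (fun k hk =>
    fderivWithin ℝ (P.psiMap k) (psiDomain n k S) (s, initial k hk (P.forward s θ), θ)
      (v, initial k hk w, 0)) (fun i => P.multiplier s θ i *
          (w i - P.stageGrad S i (s, before i (P.forward s θ)) (θ i) (v, before i w))) ?_
  · rw [hP.fderivWithin_psi0 hx hv (initial 0 n.zero_le (P.forward s θ)) (initial 0 n.zero_le w),
      ← h, initial_self, initial_self]
    let pr : (Fin m → ℝ) × (Fin n → ℝ) × (Fin n → ℝ) →L[ℝ] (Fin m → ℝ) × (Fin n → ℝ) :=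
      (ContinuousLinearMap.fst ℝ _ _).prod
        ((ContinuousLinearMap.fst ℝ _ _).comp (ContinuousLinearMap.snd ℝ _ _))
    have hpr : MapsTo pr (psiDomain n n S) (S ×ˢ univ) := fun x hx => ⟨hx.1, mem_univ _⟩
    have hxd := mem_psiDomain hx n (P.forward s θ)
    have h1 := (hP.smooth_f.hasFDerivWithinAt (hpr hxd)).comp (s, P.forward s θ, θ)
      (pr.hasFDerivWithinAt (s := psiDomain n n S)) hpr
    have h2 : P.f ∘ pr = P.psiMap n := by
      ext x; exact (P.psi_last _ _ _).symm
    rw [h2] at h1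
    rw [h1.differentiableWithinAt.hasFDerivWithinAt.apply_eq_of_convex
      (convex_psiDomain n n hP.convex) h1 hxd (v := (v, w, 0)) (add_mem_psiDomain hxd hv w)]
    rfl
  · intro i
    have h1 := hP.fderivWithin_psiMap_val i (mem_psiDomain hx i (before i (P.forward s θ)))
      hv (before i w)
    rw [extend_initial] at h1
    simp only [initial_val]
    rw [h1, hP.multiplier_eq i hx, mul_comm, ← smul_eq_mul, ← map_smul, ← map_add,
      initial_succ i w]
    congr 1
    refine Prod.ext (by simp) (Prod.ext ?_ (by simp))
    ext j
    refine Fin.lastCases ?_ (fun j => ?_) j <;> simp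

end Admissible
end StageProblem

/-! ### Feasibility of forward points, and sensitivity to one coordinate of θ -/

namespace StageProblem

variable {m n : ℕ} {P : StageProblem m n} {S : Set (Fin m → ℝ)} {Z : Set (Fin n → ℝ)}

namespace Admissible

theorem forward_constraints (hP : P.Admissible S Z) {s : Fin m → ℝ} {θ : Fin n → ℝ}
    (hx : (s, θ) ∈ boxDomain n S) (i : Fin n) :
    P.μ i (s, before i (P.forward s θ)) ≤ P.forward s θ i ∧
      P.forward s θ i ≤ P.η i (s, before i (P.forward s θ)) := by
  induction i using WellFoundedLT.induction with
  | ind i ih =>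
    have h := hP.inductivelyFeasible i s (P.forward s θ) hx.1 ih
    have h0 : 0 ≤ θ i := hx.2.1 i
    have h1 : θ i ≤ 1 := hx.2.2 i
    rw [forward_eq]
    constructor <;> simp only [stageValue] <;> nlinarith

theorem feasible_forward (hP : P.Admissible S Z) {s : Fin m → ℝ} {θ : Fin n → ℝ}
    (hx : (s, θ) ∈ boxDomain n S) : P.Feasible S s (P.forward s θ) :=
  ⟨hx.1, hP.forward_constraints hx⟩

theorem forward_mem (hP : P.Admissible S Z) {s : Fin m → ℝ} {θ : Fin n → ℝ}
    (hx : (s, θ) ∈ boxDomain n S) : P.forward s θ ∈ Z :=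
  hP.mem_of_feasible s _ (hP.feasible_forward hx)

end Admissible

theorem forward_congr_of_lt {s : Fin m → ℝ} {θ θ' : Fin n → ℝ} {i : Fin n}
    (h : ∀ j < i, θ' j = θ j) (j : Fin n) (hj : j < i) :
    P.forward s θ' j = P.forward s θ j := by
  induction j using WellFoundedLT.induction with
  | ind j ih =>
    have e : before j (P.forward s θ') = before j (P.forward s θ) := by
      ext k
      have hk : (⟨k, k.2.trans j.2⟩ : Fin n) < j := k.2
      exact ih _ hk (hk.trans hj)
    rw [forward_eq, forward_eq, e]
    simp only [stageValue, h j hj]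

theorem update_mem_boxDomain {s : Fin m → ℝ} {θ : Fin n → ℝ} (hx : (s, θ) ∈ boxDomain n S)
    (i : Fin n) {a : ℝ} (ha : a ∈ Icc (0 : ℝ) 1) :
    (s, Function.update θ i a) ∈ boxDomain n S := by
  refine ⟨hx.1, fun j => ?_, fun j => ?_⟩ <;> rcases eq_or_ne j i with rfl | hj
  · simpa using ha.1
  · simpa [hj] using hx.2.1 j
  · simpa using ha.2
  · simpa [hj] using hx.2.2 j

theorem before_forward_update (s : Fin m → ℝ) (θ : Fin n → ℝ) (i : Fin n) (a : ℝ) :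
    before i (P.forward s (Function.update θ i a)) = before i (P.forward s θ) := by
  ext k
  exact forward_congr_of_lt (i := i) (fun j hj => Function.update_of_ne hj.ne _ _) _ k.2

/-- A bound for the functions of the problem and for the functions `ψ_k`. -/
structure UniformBound (P : StageProblem m n) (S : Set (Fin m → ℝ)) (Z : Set (Fin n → ℝ))
    (R K : ℝ) : Prop where
  radius : ∀ z ∈ Z, ‖z‖ ≤ R
  diam : ∀ s ∈ S, ∀ s' ∈ S, ‖s - s'‖ ≤ R
  mu : ∀ i, TaylorBound (S ×ˢ univ) (S ×ˢ Metric.closedBall 0 R) (P.μ i) K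
  eta : ∀ i, TaylorBound (S ×ˢ univ) (S ×ˢ Metric.closedBall 0 R) (P.η i) K
  psi : ∀ k ≤ n, TaylorBound (psiDomain n k S)
    (S ×ˢ (Metric.closedBall 0 R ×ˢ Icc 0 1)) (P.psiMap k) K
  -- This makes powers of K monotone in the exponent.
  one_le : 1 ≤ K

/-- Smoothness gives bounds on bounded sets only. These suffice because Forward always lands in the
bounded set Z, and finitely many functions are involved. -/
theorem Admissible.exists_uniformBound (hP : P.Admissible S Z) :
    ∃ R K, UniformBound P S Z R K := by
  obtain ⟨R₁, hR₁⟩ := isBounded_iff_forall_norm_le.1 hP.boundedZ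
  obtain ⟨R₂, hR₂⟩ := isBounded_iff_forall_norm_le.1 hP.bounded
  set R := max R₁ (2 * R₂) with hR
  have hb : ∀ k : ℕ, Bornology.IsBounded (S ×ˢ Metric.closedBall (0 : Fin k → ℝ) R) := fun k =>
    hP.bounded.prod Metric.isBounded_closedBall
  have hb' : ∀ k : ℕ, Bornology.IsBounded
      (S ×ˢ (Metric.closedBall (0 : Fin k → ℝ) R ×ˢ Icc (0 : Fin n → ℝ) 1)) := fun k =>
    hP.bounded.prod (Metric.isBounded_closedBall.prod (Metric.isBounded_Icc _ _))
  have hs : ∀ k : ℕ, S ×ˢ Metric.closedBall (0 : Fin k → ℝ) R ⊆ S ×ˢ univ := fun k =>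
    prod_mono subset_rfl (subset_univ _)
  have hc : ∀ k : ℕ, Convex ℝ (S ×ˢ (univ : Set (Fin k → ℝ))) := fun k =>
    hP.convex.prod convex_univ
  have h1 := fun i => (hP.smooth_mu i).exists_taylorBound (hc i) (hs i) (hb i)
  have h2 := fun i => (hP.smooth_eta i).exists_taylorBound (hc i) (hs i) (hb i)
  have h3 := fun k : Fin (n + 1) => (hP.smooth_psiMap k (Nat.lt_succ_iff.1 k.2)).exists_taylorBound
    (convex_psiDomain n k hP.convex)
    (prod_mono subset_rfl (prod_mono (subset_univ _) subset_rfl)) (hb' k)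
  choose K₁ h1 using h1
  choose K₂ h2 using h2
  choose K₃ h3 using h3
  obtain ⟨M₁, hM₁⟩ := Finite.exists_le K₁
  obtain ⟨M₂, hM₂⟩ := Finite.exists_le K₂
  obtain ⟨M₃, hM₃⟩ := Finite.exists_le K₃
  refine ⟨R, max (max M₁ M₂) (max M₃ 1), fun z hz => (hR₁ z hz).trans (le_max_left _ _),
    fun s hs s' hs' => ?_, fun i => (h1 i).mono ((hM₁ i).trans (by simp)),
    fun i => (h2 i).mono ((hM₂ i).trans (by simp)),
    fun k hk => (h3 ⟨k, Nat.lt_succ_of_le hk⟩).mono ((hM₃ _).trans (by simp)), by simp⟩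
  refine le_max_of_le_right ((norm_sub_le _ _).trans ?_)
  linarith [hR₂ s hs, hR₂ s' hs']

theorem norm_snoc_zero_le (k : ℕ) (t : ℝ) :
    ‖(Fin.snoc (α := fun _ => ℝ) 0 t : Fin (k + 1) → ℝ)‖ ≤ |t| := by
  refine (pi_norm_le_iff_of_nonneg (abs_nonneg _)).2 fun j => ?_
  refine Fin.lastCases ?_ (fun j => ?_) j <;> simp

namespace UniformBound

variable {R K : ℝ}

theorem forward_initial_mem (hU : UniformBound P S Z R K) (hP : P.Admissible S Z)
    {s : Fin m → ℝ} {θ : Fin n → ℝ} (hx : (s, θ) ∈ boxDomain n S) (k : ℕ) (hk : k ≤ n) :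
    initial k hk (P.forward s θ) ∈ Metric.closedBall (0 : Fin k → ℝ) R :=
  mem_closedBall_zero_iff.2 ((norm_initial_le _ _ _).trans (hU.radius _ (hP.forward_mem hx)))

/-- With equal θⱼ the j-th coordinate is the same convex combination of two K-Lipschitz functions of
the coordinates before. -/
theorem abs_stageValue_sub_le (hU : UniformBound P S Z R K) (hP : P.Admissible S Z)
    {s : Fin m → ℝ} {θ θ' : Fin n → ℝ} (hx : (s, θ) ∈ boxDomain n S)
    (hx' : (s, θ') ∈ boxDomain n S) (j : Fin n) (hj : θ' j = θ j) :
    |P.forward s θ' j - P.forward s θ j| ≤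
      K * ‖before j (P.forward s θ') - before j (P.forward s θ)‖ := by
  have hb := hU.forward_initial_mem hP hx j j.2.le
  have hb' := hU.forward_initial_mem hP hx' j j.2.le
  rw [initial_val] at hb hb'
  have h1 := (hU.mu j).norm_sub_le (s, before j (P.forward s θ)) ⟨hx.1, hb⟩
    (s, before j (P.forward s θ')) ⟨hx.1, hb'⟩
  have h2 := (hU.eta j).norm_sub_le (s, before j (P.forward s θ)) ⟨hx.1, hb⟩
    (s, before j (P.forward s θ')) ⟨hx.1, hb'⟩
  have e : ‖(s, before j (P.forward s θ')) - (s, before j (P.forward s θ))‖ =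
      ‖before j (P.forward s θ') - before j (P.forward s θ)‖ := by
    simp [Prod.norm_def]
  rw [e, Real.norm_eq_abs, abs_le] at h1 h2
  have h0 : 0 ≤ θ j := hx.2.1 j
  have h0' : θ j ≤ 1 := hx.2.2 j
  rw [forward_eq P s θ', forward_eq P s θ]
  simp only [stageValue, hj]
  rw [abs_le]
  constructor <;> nlinarith

/-- Each stage amplifies the perturbation by at most K; the sup norm avoids a further factor for the
number of coordinates. -/
theorem abs_forward_update_sub_le (hU : UniformBound P S Z R K) (hP : P.Admissible S Z)
    {s : Fin m → ℝ} {θ : Fin n → ℝ} (hx : (s, θ) ∈ boxDomain n S) (i : Fin n) {a : ℝ}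
    (ha : a ∈ Icc (0 : ℝ) 1) (j : Fin n) :
    |P.forward s (Function.update θ i a) j - P.forward s θ j| ≤
      K ^ n * |P.forward s (Function.update θ i a) i - P.forward s θ i| := by
  set τ := |P.forward s (Function.update θ i a) i - P.forward s θ i| with hτ
  have hK := hU.one_le
  have key : |P.forward s (Function.update θ i a) j - P.forward s θ j| ≤ K ^ (j : ℕ) * τ := by
    induction j using WellFoundedLT.induction with
    | ind j ih =>
      rcases eq_or_ne j i with rfl | hj
      · exact le_mul_of_one_le_left (abs_nonneg _) (one_le_pow₀ hK)
      · refine (hU.abs_stageValue_sub_le hP hx (update_mem_boxDomain hx i ha) j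
          (Function.update_of_ne hj _ _)).trans ?_
        rcases Nat.eq_zero_or_pos (j : ℕ) with h0 | h0
        · have : before j (P.forward s (Function.update θ i a)) - before j (P.forward s θ) = 0 := by
            ext k; exact absurd k.2 (by omega)
          rw [this, norm_zero, mul_zero]
          positivity
        · obtain ⟨l, hl⟩ := Nat.exists_eq_succ_of_ne_zero h0.ne'
          rw [show K ^ (j : ℕ) = K * K ^ l by rw [hl, Nat.succ_eq_add_one, pow_succ'], mul_assoc]
          gcongr
          refine (pi_norm_le_iff_of_nonneg (by positivity)).2 fun k => ?_
          refine (ih ⟨k, k.2.trans j.2⟩ k.2).trans ?_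
          gcongr
          have := k.2
          simp only
          omega
  exact key.trans (by gcongr; exact j.2.le)

/-- The expansion is that of ψ_{i+1} in its last z variable, not of ψ₀ in θᵢ: z before i is
unchanged and ψ_{i+1} does not see θᵢ. So the error is quadratic in the change of zᵢ, and the linear
coefficient is the multiplier without the factor ηᵢ - μᵢ. -/
theorem psi0_update_le (hU : UniformBound P S Z R K) (hP : P.Admissible S Z)
    {s : Fin m → ℝ} {θ : Fin n → ℝ} (hx : (s, θ) ∈ boxDomain n S) (i : Fin n) {a : ℝ}
    (ha : a ∈ Icc (0 : ℝ) 1) :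
    P.psi0 (s, Function.update θ i a) ≤ P.psi0 (s, θ) +
      P.multiplier s θ i * (P.forward s (Function.update θ i a) i - P.forward s θ i) +
      K * (P.forward s (Function.update θ i a) i - P.forward s θ i) ^ 2 := by
  have hx' := update_mem_boxDomain hx i ha
  set θ' := Function.update θ i a with hθ'
  set τ := P.forward s θ' i - P.forward s θ i with hτ
  have h := (hU.psi (i + 1) i.2).taylor (s, initial (i + 1) i.2 (P.forward s θ), θ)
    ⟨hx.1, hU.forward_initial_mem hP hx (i + 1) i.2, hx.2⟩
    (s, initial (i + 1) i.2 (P.forward s θ'), θ)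
    ⟨hx.1, hU.forward_initial_mem hP hx' (i + 1) i.2, hx.2⟩
  have e : (s, initial (i + 1) i.2 (P.forward s θ'), θ) -
      (s, initial (i + 1) i.2 (P.forward s θ), θ) =
      (0, Fin.snoc (α := fun _ => ℝ) 0 τ, 0) := by
    rw [initial_succ, initial_succ, hθ', before_forward_update]
    refine Prod.ext (by simp) (Prod.ext ?_ (by simp))
    ext j
    refine Fin.lastCases ?_ (fun j => ?_) j <;> simp [hτ, hθ']
  have e' : ((0, Fin.snoc (α := fun _ => ℝ) 0 τ, 0) :
      (Fin m → ℝ) × (Fin (i + 1) → ℝ) × (Fin n → ℝ)) =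
      τ • (0, Fin.snoc (α := fun _ => ℝ) 0 1, 0) := by
    refine Prod.ext (by simp) (Prod.ext ?_ (by simp))
    ext j
    refine Fin.lastCases ?_ (fun j => ?_) j <;> simp
  have h1 : P.psiMap (i + 1) (s, initial (i + 1) i.2 (P.forward s θ), θ) = P.psi0 (s, θ) :=
    P.psi_initial_forward s θ (i + 1) i.2
  have h2 : P.psiMap (i + 1) (s, initial (i + 1) i.2 (P.forward s θ'), θ) = P.psi0 (s, θ') := by
    rw [← P.psi_initial_forward s θ' (i + 1) i.2]
    refine P.psi_congr _ i.2 (fun j hj => ?_) _ _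
    exact (Function.update_of_ne (Fin.ne_of_gt (Fin.lt_def.2 hj)) _ _).symm
  have h3 : ‖((0, Fin.snoc (α := fun _ => ℝ) 0 τ, 0) :
      (Fin m → ℝ) × (Fin (i + 1) → ℝ) × (Fin n → ℝ))‖ ≤ |τ| := by
    simpa [Prod.norm_def] using norm_snoc_zero_le i τ
  rw [e, h1, h2] at h
  have h4 : K * ‖((0, Fin.snoc (α := fun _ => ℝ) 0 τ, 0) :
      (Fin m → ℝ) × (Fin (i + 1) → ℝ) × (Fin n → ℝ))‖ ^ 2 ≤ K * τ ^ 2 := by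
    rw [← sq_abs τ]
    have := hU.one_le
    gcongr
  rw [e', map_smul, ← hP.multiplier_eq i hx, Real.norm_eq_abs] at h
  rw [← e'] at h
  have h5 := (le_abs_self _).trans (h.trans h4)
  rw [smul_eq_mul] at h5
  linarith

/-- For i ≤ j the multiplier yⱼ depends on s, on z up to j and on θ after j, so updating θᵢ affects
it only through z. The constant is K for the gradient of ψ_{j+1} times Kⁿ for the propagation in z.
-/
theorem abs_multiplier_update_sub_le (hU : UniformBound P S Z R K) (hP : P.Admissible S Z)
    {s : Fin m → ℝ} {θ : Fin n → ℝ} (hx : (s, θ) ∈ boxDomain n S) {i j : Fin n} (hij : i ≤ j)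
    {a : ℝ} (ha : a ∈ Icc (0 : ℝ) 1) :
    |P.multiplier s (Function.update θ i a) j - P.multiplier s θ j| ≤
      K ^ (n + 1) * |P.forward s (Function.update θ i a) i - P.forward s θ i| := by
  have hx' := update_mem_boxDomain hx i ha
  have hz : ‖P.forward s (Function.update θ i a) - P.forward s θ‖ ≤
      K ^ n * |P.forward s (Function.update θ i a) i - P.forward s θ i| :=
    (pi_norm_le_iff_of_nonneg (by have := hU.one_le; positivity)).2
      (hU.abs_forward_update_sub_le hP hx i ha)
  set θ' := Function.update θ i a with hθ'
  have h1 : P.multiplier s θ' j = fderivWithin ℝ (P.psiMap (j + 1)) (psiDomain n (j + 1) S)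
      (s, initial (j + 1) j.2 (P.forward s θ'), θ) (0, Fin.snoc (α := fun _ => ℝ) 0 1, 0) := by
    rw [initial_succ, ← (hP.hasDerivAt_psi_snoc j hx _ _).deriv, multiplier]
    congr 1
    ext t
    refine P.psi_congr _ j.2 (fun k hk => Function.update_of_ne (Fin.ne_of_gt ?_) _ _) _ _
    exact hij.trans_lt (Fin.lt_def.2 hk)
  rw [h1, hP.multiplier_eq j hx]
  refine ((hU.psi (j + 1) j.2).norm_fderiv_sub_le _
    ⟨hx.1, hU.forward_initial_mem hP hx (j + 1) j.2, hx.2⟩ _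
    ⟨hx.1, hU.forward_initial_mem hP hx' (j + 1) j.2, hx.2⟩ _ ?_ ?_).trans ?_
  · exact Admissible.add_mem_psiDomain (Admissible.mem_psiDomain hx _ _) (by simpa using hx.1) _
  · exact Admissible.add_mem_psiDomain (Admissible.mem_psiDomain hx _ _) (by simpa using hx.1) _
  · have h2 : ‖((0, Fin.snoc (α := fun _ => ℝ) 0 1, 0) :
        (Fin m → ℝ) × (Fin (j + 1) → ℝ) × (Fin n → ℝ))‖ ≤ 1 := by
      simpa [Prod.norm_def] using norm_snoc_zero_le j 1
    have h3 : ‖(s, initial (j + 1) j.2 (P.forward s θ'), θ) -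
        (s, initial (j + 1) j.2 (P.forward s θ), θ)‖ ≤ ‖P.forward s θ' - P.forward s θ‖ := by
      have h4 := norm_initial_le (j + 1) j.2 (P.forward s θ' - P.forward s θ)
      rw [show initial (j + 1) j.2 (P.forward s θ' - P.forward s θ) =
        initial (j + 1) j.2 (P.forward s θ') - initial (j + 1) j.2 (P.forward s θ) from rfl] at h4
      simpa [Prod.norm_def] using h4
    have := hU.one_le
    calc _ ≤ K * (K ^ n * |P.forward s θ' i - P.forward s θ i|) * 1 := by
          gcongr
          exact h3.trans hz
      _ = _ := by ring

end UniformBound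
end StageProblem

/-! ### The Lagrangian and the duality gap -/

/-- The map `(s, z) ↦ (s, z_{<i})`. -/
noncomputable def beforeCLM {n : ℕ} (m : ℕ) (i : Fin n) :
    (Fin m → ℝ) × (Fin n → ℝ) →L[ℝ] (Fin m → ℝ) × (Fin i → ℝ) :=
  (ContinuousLinearMap.fst ℝ _ _).prod
    ((ContinuousLinearMap.pi fun j : Fin i =>
      ContinuousLinearMap.proj (⟨j, j.2.trans i.2⟩ : Fin n)).comp
        (ContinuousLinearMap.snd ℝ _ _))

@[simp]
theorem beforeCLM_apply {m n : ℕ} (i : Fin n) (x : (Fin m → ℝ) × (Fin n → ℝ)) :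
    beforeCLM m i x = (x.1, before i x.2) := rfl

namespace GradientReply

variable {m n : ℕ}

/-- The gradient of the Lagrangian, computed from the data of a forward and backward pass. -/
noncomputable def lagrangianGrad (r : GradientReply m n) (y : Fin n → ℝ) :
    (Fin m → ℝ) × (Fin n → ℝ) →L[ℝ] ℝ :=
  r.gradF + ∑ i, (max (y i) 0 • (r.gradMu i).comp (beforeCLM m i)
    - max (-y i) 0 • (r.gradEta i).comp (beforeCLM m i)
    - y i • (ContinuousLinearMap.proj i).comp (ContinuousLinearMap.snd ℝ (Fin m → ℝ) _))

/-- The duality gap, computed from the data of a forward and backward pass. -/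
noncomputable def gap (r : GradientReply m n) (S : Set (Fin m → ℝ)) (Z : Set (Fin n → ℝ))
    (s : Fin m → ℝ) (y : Fin n → ℝ) : ℝ :=
  (∑ i, (y i * r.z i - max (y i) 0 * r.valueMu i + max (-y i) 0 * r.valueEta i))
    + sSup ((fun x => r.lagrangianGrad y ((s, r.z) - x)) '' (S ×ˢ Z))

theorem lagrangianGrad_apply (r : GradientReply m n) (y : Fin n → ℝ)
    (x : (Fin m → ℝ) × (Fin n → ℝ)) : r.lagrangianGrad y x =
      r.gradF x + ∑ i, (max (y i) 0 * r.gradMu i (x.1, before i x.2)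
        - max (-y i) 0 * r.gradEta i (x.1, before i x.2) - y i * x.2 i) := by
  simp [lagrangianGrad]

end GradientReply

namespace StageProblem

variable {m n : ℕ} {P : StageProblem m n} {S : Set (Fin m → ℝ)} {Z : Set (Fin n → ℝ)}

theorem convexOn_lagrangian (hP : P.Admissible S Z) (y : Fin n → ℝ) :
    ConvexOn ℝ (S ×ˢ univ) (P.lagrangian y) := by
  have hX : Convex ℝ (S ×ˢ (univ : Set (Fin n → ℝ))) := hP.convex.prod convex_univ
  have h1 : ∀ i : Fin n, ConvexOn ℝ (S ×ˢ univ) fun x : (Fin m → ℝ) × (Fin n → ℝ) =>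
      P.μ i (x.1, before i x.2) := fun i =>
    ((hP.convex_mu i).comp_linearMap (beforeCLM m i).toLinearMap).subset
      (fun x hx => ⟨hx.1, mem_univ _⟩) hX
  have h2 : ∀ i : Fin n, ConcaveOn ℝ (S ×ˢ univ) fun x : (Fin m → ℝ) × (Fin n → ℝ) =>
      P.η i (x.1, before i x.2) := fun i =>
    ((hP.concave_eta i).comp_linearMap (beforeCLM m i).toLinearMap).subset
      (fun x hx => ⟨hx.1, mem_univ _⟩) hX
  refine ⟨hX, fun x hx x' hx' a b ha hb hab => ?_⟩
  have hf := hP.convex_f.2 hx hx' ha hb hab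
  simp only [lagrangian, smul_eq_mul] at hf ⊢
  rw [mul_add, mul_add, add_add_add_comm, Finset.mul_sum, Finset.mul_sum,
    ← Finset.sum_add_distrib]
  refine add_le_add hf (Finset.sum_le_sum fun i _ => ?_)
  have e1 := mul_le_mul_of_nonneg_left ((h1 i).2 hx hx' ha hb hab) (le_max_right (y i) 0)
  have e2 := mul_le_mul_of_nonneg_left ((h2 i).2 hx hx' ha hb hab) (le_max_right (-y i) 0)
  simp only [smul_eq_mul, Prod.snd_add, Prod.smul_snd, Pi.add_apply, Pi.smul_apply] at e1 e2 ⊢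
  linarith

/-- Weak duality: after splitting y = y⁺ - y⁻, each summand is a nonnegative weight times a
constraint violation, which is nonpositive at feasible points. -/
theorem lagrangian_le_of_feasible (y : Fin n → ℝ) {s : Fin m → ℝ} {z : Fin n → ℝ}
    (h : P.Feasible S s z) : P.lagrangian y (s, z) ≤ P.f (s, z) := by
  refine add_le_of_nonpos_right (Finset.sum_nonpos fun i _ => ?_)
  have h1 := mul_le_mul_of_nonneg_left (h.2 i).1 (le_max_right (y i) 0)
  have h2 := mul_le_mul_of_nonneg_left (h.2 i).2 (le_max_right (-y i) 0)
  have h3 : y i = max (y i) 0 - max (-y i) 0 := (max_zero_sub_eq_self (y i)).symm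
  have h4 : y i * z i = max (y i) 0 * z i - max (-y i) 0 * z i := by rw [← sub_mul, ← h3]
  simp only
  linarith

theorem hasFDerivWithinAt_lagrangian (hP : P.Admissible S Z) (y : Fin n → ℝ) {s : Fin m → ℝ}
    {θ : Fin n → ℝ} (hx : (s, θ) ∈ boxDomain n S) :
    HasFDerivWithinAt (P.lagrangian y) ((P.gradientReply S (s, θ)).lagrangianGrad y)
      (S ×ˢ univ) (s, P.forward s θ) := by
  have hb : ∀ i : Fin n, MapsTo (beforeCLM m i) (S ×ˢ univ) (S ×ˢ univ) :=
    fun i x hx => ⟨hx.1, mem_univ _⟩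
  have hz : (s, P.forward s θ) ∈ S ×ˢ (univ : Set (Fin n → ℝ)) := ⟨hx.1, mem_univ _⟩
  refine (hP.smooth_f.hasFDerivWithinAt hz).add (HasFDerivWithinAt.fun_sum fun i _ => ?_)
  have h1 := ((hP.smooth_mu i).hasFDerivWithinAt (hb i hz)).comp _
    ((beforeCLM m i).hasFDerivWithinAt (s := S ×ˢ univ)) (hb i)
  have h2 := ((hP.smooth_eta i).hasFDerivWithinAt (hb i hz)).comp _
    ((beforeCLM m i).hasFDerivWithinAt (s := S ×ˢ univ)) (hb i)
  have h3 := ((ContinuousLinearMap.proj (R := ℝ) (φ := fun _ : Fin n => ℝ) i).comp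
    (ContinuousLinearMap.snd ℝ (Fin m → ℝ) _)).hasFDerivWithinAt
      (x := (s, P.forward s θ)) (s := S ×ˢ univ)
  exact ((h1.const_mul _).sub (h2.const_mul _)).sub (h3.const_mul (y i))

theorem fderivWithin_lagrangian (hP : P.Admissible S Z) (y : Fin n → ℝ) {s : Fin m → ℝ}
    {θ : Fin n → ℝ} (hx : (s, θ) ∈ boxDomain n S) {x : (Fin m → ℝ) × (Fin n → ℝ)}
    (hx1 : x.1 ∈ S) :
    fderivWithin ℝ (P.lagrangian y) (S ×ˢ univ) (s, P.forward s θ) ((s, P.forward s θ) - x) =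
      (P.gradientReply S (s, θ)).lagrangianGrad y ((s, P.forward s θ) - x) := by
  have h := hasFDerivWithinAt_lagrangian hP y hx
  have h1 := h.differentiableWithinAt.hasFDerivWithinAt.apply_eq_of_convex
    (hP.convex.prod convex_univ) h ⟨hx.1, mem_univ _⟩ (v := x - (s, P.forward s θ))
    (by rw [add_sub_cancel]; exact ⟨hx1, mem_univ _⟩)
  rw [← neg_sub x, map_neg, map_neg, h1]

/-- The supremum involves only directions towards S × Z, where the relative derivative is unique. So
the gap can serve as a stopping test. -/
theorem dualityGap_eq_gap (hP : P.Admissible S Z) {s : Fin m → ℝ}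
    {θ : Fin n → ℝ} (hx : (s, θ) ∈ boxDomain n S) :
    P.dualityGap S Z s θ = (P.gradientReply S (s, θ)).gap S Z s (P.multiplier s θ) := by
  simp only [dualityGap, GradientReply.gap]
  congr 2
  exact image_congr fun x hx' => fderivWithin_lagrangian hP _ hx hx'.1

/-- How far `θ_i` is from the end of `[0,1]` that the sign of the multiplier asks for, weighted
with the size of the multiplier. -/
noncomputable def residual (P : StageProblem m n) (s : Fin m → ℝ) (θ : Fin n → ℝ)
    (i : Fin n) : ℝ :=
  θ i * max (P.multiplier s θ i) 0 + (1 - θ i) * max (-P.multiplier s θ i) 0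

theorem residual_nonneg {s : Fin m → ℝ} {θ : Fin n → ℝ} (hx : (s, θ) ∈ boxDomain n S)
    (i : Fin n) : 0 ≤ P.residual s θ i :=
  add_nonneg (mul_nonneg (hx.2.1 i) (le_max_right _ _))
    (mul_nonneg (sub_nonneg.2 (hx.2.2 i)) (le_max_right _ _))

/-- The left side is y⁺(z-μ) + y⁻(η-z), and z-μ = θ(η-μ), η-z = (1-θ)(η-μ). -/
theorem complementarity_eq (s : Fin m → ℝ) (θ : Fin n → ℝ) (i : Fin n) :
    P.multiplier s θ i * P.forward s θ i
      - max (P.multiplier s θ i) 0 * P.μ i (s, before i (P.forward s θ))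
      + max (-P.multiplier s θ i) 0 * P.η i (s, before i (P.forward s θ)) =
    P.residual s θ i *
      (P.η i (s, before i (P.forward s θ)) - P.μ i (s, before i (P.forward s θ))) := by
  have h3 := max_zero_sub_eq_self (P.multiplier s θ i)
  rw [residual]
  set a := max (P.multiplier s θ i) 0
  set b := max (-P.multiplier s θ i) 0
  rw [← h3, forward_eq, stageValue]
  ring

/-- In `gradient_identity` the terms yᵢwᵢ cancel against the Lagrangian. The remaining coefficient
of ∇μᵢ is yᵢ⁺ - (1-θᵢ)yᵢ, the residual, and that of ∇ηᵢ is its negative. -/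
theorem lagrangianGrad_eq (hP : P.Admissible S Z) {s v : Fin m → ℝ}
    {θ : Fin n → ℝ} (hx : (s, θ) ∈ boxDomain n S) (hv : s + v ∈ S) (w : Fin n → ℝ) :
    (P.gradientReply S (s, θ)).lagrangianGrad (P.multiplier s θ) (v, w) =
      fderivWithin ℝ P.psi0 (boxDomain n S) (s, θ) (v, 0) + ∑ i, P.residual s θ i *
        (fderivWithin ℝ (P.μ i) (S ×ˢ univ) (s, before i (P.forward s θ)) (v, before i w) -
          fderivWithin ℝ (P.η i) (S ×ˢ univ) (s, before i (P.forward s θ)) (v, before i w)) := by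
  rw [GradientReply.lagrangianGrad_apply]
  simp only [gradientReply]
  rw [hP.gradient_identity hx hv w, add_assoc, ← Finset.sum_add_distrib]
  congr 1
  refine Finset.sum_congr rfl fun i _ => ?_
  have h3 := max_zero_sub_eq_self (P.multiplier s θ i)
  rw [residual]
  set a := max (P.multiplier s θ i) 0
  set b := max (-P.multiplier s θ i) 0
  rw [← h3]
  simp [stageGrad]
  ring

theorem bddAbove_image_sub (hP : P.Admissible S Z) (A : (Fin m → ℝ) × (Fin n → ℝ) →L[ℝ] ℝ)
    (x : (Fin m → ℝ) × (Fin n → ℝ)) :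
    BddAbove ((fun x' => A (x - x')) '' (S ×ˢ Z)) := by
  obtain ⟨R, hR⟩ := isBounded_iff_forall_norm_le.1 (hP.bounded.prod hP.boundedZ)
  refine ⟨‖A‖ * (‖x‖ + R), ?_⟩
  rintro _ ⟨x', hx', rfl⟩
  refine (le_abs_self _).trans ((A.le_opNorm _).trans ?_)
  gcongr
  exact (norm_sub_le _ _).trans (by linarith [hR x' hx'])

/-- The sum in the gap is f - 𝓛 at the current point, and the convex function 𝓛 lies above its
linearization there. -/
theorem sub_dualityGap_le_lagrangian (hP : P.Admissible S Z) {s : Fin m → ℝ} {θ : Fin n → ℝ}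
    (hx : (s, θ) ∈ boxDomain n S) {x : (Fin m → ℝ) × (Fin n → ℝ)} (hx' : x ∈ S ×ˢ Z) :
    P.f (s, P.forward s θ) - P.dualityGap S Z s θ ≤ P.lagrangian (P.multiplier s θ) x := by
  have hz : (s, P.forward s θ) ∈ S ×ˢ (univ : Set (Fin n → ℝ)) := ⟨hx.1, mem_univ _⟩
  have h1 := (convexOn_lagrangian hP (P.multiplier s θ)).add_fderiv_le (y := x) hz
    ⟨hx'.1, mem_univ _⟩ (hasFDerivWithinAt_lagrangian hP _ hx)
  have h2 := le_csSup (bddAbove_image_sub hP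
    ((P.gradientReply S (s, θ)).lagrangianGrad (P.multiplier s θ)) (s, P.forward s θ))
    (mem_image_of_mem _ hx')
  rw [← neg_sub, map_neg] at h1
  rw [dualityGap_eq_gap hP hx, GradientReply.gap]
  simp only [gradientReply] at h1 h2 ⊢
  have h3 : P.lagrangian (P.multiplier s θ) (s, P.forward s θ) = P.f (s, P.forward s θ) -
      ∑ i, (P.multiplier s θ i * P.forward s θ i
      - max (P.multiplier s θ i) 0 * P.μ i (s, before i (P.forward s θ))
      + max (-P.multiplier s θ i) 0 * P.η i (s, before i (P.forward s θ))) := by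
    rw [lagrangian, sub_eq_add_neg, ← Finset.sum_neg_distrib]
    congr 1
    exact Finset.sum_congr rfl fun i _ => by ring
  linarith

namespace UniformBound

variable {R K : ℝ}

theorem psi0_add_smul_le (hU : UniformBound P S Z R K) (hP : P.Admissible S Z)
    {s s' : Fin m → ℝ} {θ : Fin n → ℝ} (hx : (s, θ) ∈ boxDomain n S) (hs' : s' ∈ S)
    {γ : ℝ} (hγ : γ ∈ Icc (0 : ℝ) 1) :
    P.psi0 (s + γ • (s' - s), θ) ≤ P.psi0 (s, θ) -
      γ * fderivWithin ℝ P.psi0 (boxDomain n S) (s, θ) (s - s', 0) + K * R ^ 2 * γ ^ 2 := by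
  have hγS : s + γ • (s' - s) ∈ S := hP.convex.add_smul_sub_mem hx.1 hs' hγ
  have h0 : (0 : Fin 0 → ℝ) ∈ Metric.closedBall (0 : Fin 0 → ℝ) R := by
    simpa using (norm_nonneg _).trans (hU.diam s hx.1 s hx.1)
  have h := (hU.psi 0 n.zero_le).taylor (s, 0, θ) ⟨hx.1, h0, hx.2⟩
    (s + γ • (s' - s), 0, θ) ⟨hγS, h0, hx.2⟩
  have e : (s + γ • (s' - s), (0 : Fin 0 → ℝ), θ) - (s, 0, θ) = γ • (s' - s, 0, 0) :=
    Prod.ext (by simp) (Prod.ext (Subsingleton.elim _ _) (by simp))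
  have e1 : ∀ s₁, P.psiMap 0 (s₁, 0, θ) = P.psi0 (s₁, θ) := fun s₁ => by
    simp only [psiMap, psi0]
    congr 1
    exact Subsingleton.elim _ _
  rw [e, map_smul, ← hP.fderivWithin_psi0 hx (by rw [add_sub_cancel]; exact hs') 0 0, e1, e1,
    smul_eq_mul, norm_smul, Real.norm_eq_abs] at h
  have e2 : ‖((s' - s, 0, 0) : (Fin m → ℝ) × (Fin 0 → ℝ) × (Fin n → ℝ))‖ ≤ R := by
    have h1 := hU.diam s' hs' s hx.1
    have h2 := (norm_nonneg _).trans h1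
    exact max_le h1 (max_le (by rwa [norm_zero]) (by rwa [norm_zero]))
  have e3 : (s - s', (0 : Fin n → ℝ)) = -(s' - s, 0) := by simp
  rw [e3, map_neg]
  have h1 := (le_abs_self _).trans h
  have h2 : K * (‖γ‖ * ‖((s' - s, 0, 0) : (Fin m → ℝ) × (Fin 0 → ℝ) × (Fin n → ℝ))‖) ^ 2 ≤
      K * R ^ 2 * γ ^ 2 := by
    have := hU.one_le
    rw [mul_pow, Real.norm_eq_abs, sq_abs, mul_assoc, mul_comm (R ^ 2)]
    gcongr
  linarith

theorem abs_fderivWithin_psi0_le (hU : UniformBound P S Z R K) (hP : P.Admissible S Z)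
    {s s' : Fin m → ℝ} {θ : Fin n → ℝ} (hx : (s, θ) ∈ boxDomain n S) (hs' : s' ∈ S) :
    |fderivWithin ℝ P.psi0 (boxDomain n S) (s, θ) (s - s', 0)| ≤ K * R := by
  have h0 : (0 : Fin 0 → ℝ) ∈ Metric.closedBall (0 : Fin 0 → ℝ) R := by
    simpa using (norm_nonneg _).trans (hU.diam s hx.1 s hx.1)
  have hadd : s + (s' - s) ∈ S := by rwa [add_sub_cancel]
  have h := (hU.psi 0 n.zero_le).norm_fderiv_le (s, 0, θ) ⟨hx.1, h0, hx.2⟩ (s' - s, 0, 0)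
    (Admissible.add_mem_psiDomain (Admissible.mem_psiDomain hx 0 0) hadd 0)
  rw [← hP.fderivWithin_psi0 hx hadd, Real.norm_eq_abs] at h
  have e3 : (s - s', (0 : Fin n → ℝ)) = -(s' - s, 0) := by simp
  have e2 : ‖((s' - s, 0, 0) : (Fin m → ℝ) × (Fin 0 → ℝ) × (Fin n → ℝ))‖ ≤ R := by
    have h1 := hU.diam s' hs' s hx.1
    have h2 := (norm_nonneg _).trans h1
    exact max_le h1 (max_le (by rwa [norm_zero]) (by rwa [norm_zero]))
  rw [e3, map_neg, abs_neg]
  have := hU.one_le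
  exact h.trans (by gcongr)

theorem abs_psi0_le (hU : UniformBound P S Z R K) {x : (Fin m → ℝ) × (Fin n → ℝ)}
    (hx : x ∈ boxDomain n S) : |P.psi0 x| ≤ K := by
  have h0 : (0 : Fin 0 → ℝ) ∈ Metric.closedBall (0 : Fin 0 → ℝ) R := by
    simpa using (norm_nonneg _).trans (hU.diam x.1 hx.1 x.1 hx.1)
  have h := (hU.psi 0 n.zero_le).norm_le (x.1, 0, x.2) ⟨hx.1, h0, hx.2⟩
  rw [show (0 : Fin 0 → ℝ) = Fin.elim0 from Subsingleton.elim _ _] at h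
  exact h

/-- The term 2K bounds ηᵢ - μᵢ. The term 4KR bounds the difference of two gradients of size K in a
direction of length at most 2R. -/
theorem dualityGap_le (hU : UniformBound P S Z R K) (hP : P.Admissible S Z)
    {s : Fin m → ℝ} {θ : Fin n → ℝ} (hx : (s, θ) ∈ boxDomain n S) {b : ℝ}
    (hb : ∀ s' ∈ S, fderivWithin ℝ P.psi0 (boxDomain n S) (s, θ) (s - s', 0) ≤ b) :
    P.dualityGap S Z s θ ≤ (2 * K + 4 * K * R) * (∑ i, P.residual s θ i) + b := by
  have hK := hU.one_le
  have hR : 0 ≤ R := (norm_nonneg _).trans (hU.diam s hx.1 s hx.1)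
  have hmem : ∀ i : Fin n, (s, before i (P.forward s θ)) ∈ S ×ˢ Metric.closedBall 0 R :=
    fun i => ⟨hx.1, hU.forward_initial_mem hP hx i i.2.le⟩
  have h1 : ∑ i, (P.multiplier s θ i * P.forward s θ i
      - max (P.multiplier s θ i) 0 * P.μ i (s, before i (P.forward s θ))
      + max (-P.multiplier s θ i) 0 * P.η i (s, before i (P.forward s θ))) ≤
      2 * K * ∑ i, P.residual s θ i := by
    rw [Finset.mul_sum]
    refine Finset.sum_le_sum fun i _ => ?_
    rw [complementarity_eq, mul_comm]
    refine mul_le_mul_of_nonneg_right ?_ (residual_nonneg hx i)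
    have e1 := abs_le.1 ((hU.mu i).norm_le _ (hmem i))
    have e2 := abs_le.1 ((hU.eta i).norm_le _ (hmem i))
    linarith
  have h2 : sSup ((fun x => (P.gradientReply S (s, θ)).lagrangianGrad (P.multiplier s θ)
      ((s, P.forward s θ) - x)) '' (S ×ˢ Z)) ≤ 4 * K * R * (∑ i, P.residual s θ i) + b := by
    refine csSup_le ⟨_, mem_image_of_mem _ (mk_mem_prod hx.1 (hP.forward_mem hx))⟩ ?_
    rintro _ ⟨x, hxm, rfl⟩
    have hadd : s + (x.1 - s) ∈ S := by rw [add_sub_cancel]; exact hxm.1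
    have e := lagrangianGrad_eq hP hx hadd (x.2 - P.forward s θ)
    have e1 : (s, P.forward s θ) - x = -(x.1 - s, x.2 - P.forward s θ) := by
      ext <;> simp
    have e3 : (s - x.1, (0 : Fin n → ℝ)) = -(x.1 - s, 0) := by simp
    have e4 := hb x.1 hxm.1
    rw [e3, map_neg] at e4
    simp only
    rw [e1, map_neg, e, neg_add, add_comm]
    refine add_le_add ?_ e4
    rw [← Finset.sum_neg_distrib, Finset.mul_sum]
    refine Finset.sum_le_sum fun i _ => ?_
    rw [← mul_neg, mul_comm]
    refine mul_le_mul_of_nonneg_right ?_ (residual_nonneg hx i)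
    have hn : ‖(x.1 - s, before i (x.2 - P.forward s θ))‖ ≤ 2 * R := by
      refine max_le ((hU.diam _ hxm.1 _ hx.1).trans (by linarith)) ?_
      refine (norm_initial_le i i.2.le _).trans ((norm_sub_le _ _).trans ?_)
      linarith [hU.radius _ hxm.2, hU.radius _ (hP.forward_mem hx)]
    have a1 := (hU.mu i).norm_fderiv_le _ (hmem i) (x.1 - s, before i (x.2 - P.forward s θ))
      ⟨hadd, mem_univ _⟩
    have a2 := (hU.eta i).norm_fderiv_le _ (hmem i) (x.1 - s, before i (x.2 - P.forward s θ))
      ⟨hadd, mem_univ _⟩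
    have a3 := mul_le_mul_of_nonneg_left hn (zero_le_one.trans hK)
    have b1 := abs_le.1 (a1.trans a3)
    have b2 := abs_le.1 (a2.trans a3)
    linarith
  rw [dualityGap_eq_gap hP hx, GradientReply.gap]
  simp only [gradientReply] at h2 ⊢
  linarith

end UniformBound
end StageProblem

/-! ### The steps of the algorithm, computed from the replies -/

namespace GradientReply

variable {m n : ℕ}

/-- The multipliers, computed backwards from the data of a forward and backward pass at a point
with the coordinates `θ`. -/
noncomputable def multiplier (r : GradientReply m n) (θ : Fin n → ℝ) (k : Fin n) : ℝ :=
  r.gradF (0, Pi.single k 1) + ∑ i, if _ : k < i then multiplier r θ i *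
    ((1 - θ i) * r.gradMu i (0, before i (Pi.single k 1)) +
      θ i * r.gradEta i (0, before i (Pi.single k 1))) else 0
termination_by n - k.val
decreasing_by omega

end GradientReply

/-- This is `gradient_identity` with v = 0 and w the k-th unit vector: stages up to k do not see
that direction, so the identity can be solved for y_k in terms of later multipliers. -/
theorem StageProblem.Admissible.gradientReply_multiplier {m n : ℕ} {P : StageProblem m n}
    {S : Set (Fin m → ℝ)} {Z : Set (Fin n → ℝ)} (hP : P.Admissible S Z) {s : Fin m → ℝ}
    {θ : Fin n → ℝ} (hx : (s, θ) ∈ boxDomain n S) (k : Fin n) :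
    (P.gradientReply S (s, θ)).multiplier θ k = P.multiplier s θ k := by
  induction k using WellFoundedGT.induction with
  | ind k ih =>
    have h := hP.gradient_identity (v := 0) hx (by simpa using hx.1) (Pi.single k 1)
    have h1 : ∑ i, P.multiplier s θ i * (Pi.single k 1 : Fin n → ℝ) i = P.multiplier s θ k := by
      simp [Pi.single_apply]
    simp only [mul_sub, Finset.sum_sub_distrib, h1, ← Prod.zero_eq_mk, map_zero, zero_add] at h
    rw [GradientReply.multiplier]
    simp only [StageProblem.gradientReply] at ih ⊢
    rw [h, sub_add, sub_eq_self, sub_eq_zero]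
    refine Finset.sum_congr rfl fun i _ => ?_
    split_ifs with hi
    · rw [ih i hi]
      simp [StageProblem.stageGrad]
    · have e : before i (Pi.single k 1 : Fin n → ℝ) = 0 := by
        ext j
        refine Pi.single_eq_of_ne (Fin.ne_of_lt ?_) _
        exact Fin.lt_def.2 (j.2.trans_le (not_lt.1 hi))
      rw [e, ← Prod.zero_eq_mk, map_zero, mul_zero]

/-- A part `t ∈ [0, 1]` of the way from `θ` to the end of `[0, 1]` that the sign of `y` asks for:
the whole way if this changes `θ d` by at most `c |y|`, and else the part that does. -/
noncomputable def moveToEnd (c y d θ : ℝ) : ℝ :=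
  θ + (if |(if 0 < y then 0 else 1) - θ| * d ≤ c * |y| then 1 else
    c * |y| / (|(if 0 < y then 0 else 1) - θ| * d)) * ((if 0 < y then 0 else 1) - θ)

/-- Here d stands for ηᵢ - μᵢ, so (new θ - θ)d is the change of zᵢ. The final alternative drives the
analysis: zero residual for the old multiplier, or a move of the full length c|y|. If d = 0 the
whole way to the end is taken without changing z. -/
theorem moveToEnd_spec {c y d θ : ℝ} (hc : 0 < c) (hd : 0 ≤ d) (hθ : θ ∈ Icc (0 : ℝ) 1) :
    moveToEnd c y d θ ∈ Icc (0 : ℝ) 1 ∧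
      y * ((moveToEnd c y d θ - θ) * d) = -(|y| * |(moveToEnd c y d θ - θ) * d|) ∧
      |(moveToEnd c y d θ - θ) * d| ≤ c * |y| ∧
      (moveToEnd c y d θ * max y 0 + (1 - moveToEnd c y d θ) * max (-y) 0 = 0 ∨
        |(moveToEnd c y d θ - θ) * d| = c * |y|) := by
  obtain ⟨h0, h1⟩ := hθ
  have key : ∀ b : ℝ, b ∈ Icc (0 : ℝ) 1 → y * (b - θ) = -(|y| * |b - θ|) →
      b * max y 0 + (1 - b) * max (-y) 0 = 0 → ∀ a, a = θ + (if |b - θ| * d ≤ c * |y| then 1 else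
        c * |y| / (|b - θ| * d)) * (b - θ) → a ∈ Icc (0 : ℝ) 1 ∧
      y * ((a - θ) * d) = -(|y| * |(a - θ) * d|) ∧ |(a - θ) * d| ≤ c * |y| ∧
      (a * max y 0 + (1 - a) * max (-y) 0 = 0 ∨ |(a - θ) * d| = c * |y|) := by
    intro b hb hyb hres a ha
    split_ifs at ha with hD
    · have e : a = b := by rw [ha]; ring
      subst e
      rw [abs_mul, abs_of_nonneg hd]
      exact ⟨hb, by linear_combination d * hyb, hD, Or.inl hres⟩
    · have hD' := not_le.1 hD
      have hcy : 0 ≤ c * |y| := by positivity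
      have hpos : 0 < |b - θ| * d := hcy.trans_lt hD'
      set l := c * |y| / (|b - θ| * d) with hl
      have hl0 : 0 ≤ l := by positivity
      have hl1 : l ≤ 1 := (div_le_one hpos).2 hD'.le
      have e : a - θ = l * (b - θ) := by rw [ha]; ring
      have e1 : |(a - θ) * d| = c * |y| := by
        rw [e, abs_mul, abs_mul, abs_of_nonneg hd, abs_of_nonneg hl0, hl, mul_assoc,
          div_mul_cancel₀ _ hpos.ne']
      have e2 : |(a - θ) * d| = l * |b - θ| * d := by
        rw [e, abs_mul, abs_mul, abs_of_nonneg hd, abs_of_nonneg hl0]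
      refine ⟨⟨?_, ?_⟩, ?_, e1.le, Or.inr e1⟩
      · rw [ha]; nlinarith [hb.1]
      · rw [ha]; nlinarith [hb.2]
      · rw [e2, e]; linear_combination l * d * hyb
  by_cases hy : 0 < y
  · refine key 0 (by simp) ?_ ?_ _ ?_
    · rw [abs_of_pos hy, abs_of_nonpos (by linarith)]; ring
    · rw [max_eq_right (by linarith : -y ≤ 0)]; ring
    · simp [moveToEnd, hy]
  · refine key 1 (by simp) ?_ ?_ _ ?_
    · rw [abs_of_nonpos (not_lt.1 hy), abs_of_nonneg (by linarith)]; ring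
    · rw [max_eq_right (not_lt.1 hy)]; ring
    · simp only [moveToEnd, if_neg hy]

namespace GradientReply

variable {m n : ℕ}

/-- The step that moves the coordinate `θ_i`. -/
noncomputable def coordStep (r : GradientReply m n) (c : ℝ) (i : Fin n)
    (x : (Fin m → ℝ) × (Fin n → ℝ)) : (Fin m → ℝ) × (Fin n → ℝ) :=
  (x.1, Function.update x.2 i
    (moveToEnd c (r.multiplier x.2 i) (r.valueEta i - r.valueMu i) (x.2 i)))

open Classical in
/-- A point of `S` that minimizes the linearization of `ψ₀` in `s` up to a factor. -/
noncomputable def linearMinimizer (r : GradientReply m n) (S : Set (Fin m → ℝ))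
    (s : Fin m → ℝ) : Fin m → ℝ :=
  if h : ∃ t ∈ S, ∀ s' ∈ S, r.gradPsi (s - s', 0) ≤ 2 * r.gradPsi (s - t, 0) then h.choose else s

/-- A Frank-Wolfe step in `s`. -/
noncomputable def stateStep (r : GradientReply m n) (S : Set (Fin m → ℝ)) (c : ℝ)
    (x : (Fin m → ℝ) × (Fin n → ℝ)) : (Fin m → ℝ) × (Fin n → ℝ) :=
  (x.1 + min 1 (c * r.gradPsi (x.1 - r.linearMinimizer S x.1, 0)) •
    (r.linearMinimizer S x.1 - x.1), x.2)

/-- The step at position `p` of a sweep, which moves the coordinates of `θ` in decreasing order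
and then `s`. -/
noncomputable def sweepStep (r : GradientReply m n) (S : Set (Fin m → ℝ)) (c : ℝ) (p : ℕ)
    (x : (Fin m → ℝ) × (Fin n → ℝ)) : (Fin m → ℝ) × (Fin n → ℝ) :=
  if h : p < n then r.coordStep c (Fin.rev ⟨p, h⟩) x else r.stateStep S c x

/-- S need not be closed, so the supremum may not be attained. If it is positive, a point above half
of it will do; if no point would do, testing t = s shows that it is positive. -/
theorem linearMinimizer_spec (r : GradientReply m n) {S : Set (Fin m → ℝ)} {s : Fin m → ℝ}
    (hs : s ∈ S) {b : ℝ} (hb : ∀ s' ∈ S, r.gradPsi (s - s', 0) ≤ b) :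
    r.linearMinimizer S s ∈ S ∧
      ∀ s' ∈ S, r.gradPsi (s - s', 0) ≤ 2 * r.gradPsi (s - r.linearMinimizer S s, 0) := by
  have h : ∃ t ∈ S, ∀ s' ∈ S, r.gradPsi (s - s', 0) ≤ 2 * r.gradPsi (s - t, 0) := by
    by_contra! hcon
    have hpos : ∀ t ∈ S, 0 ≤ r.gradPsi (s - t, 0) → 0 < sSup
        ((fun s' => r.gradPsi (s - s', 0)) '' S) := fun t ht h0 => by
      obtain ⟨s', hs', h'⟩ := hcon t ht
      exact ((mul_nonneg zero_le_two h0).trans_lt h').trans_le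
        (le_csSup ⟨b, by rintro _ ⟨u, hu, rfl⟩; exact hb u hu⟩ (mem_image_of_mem _ hs'))
    have h0 := hpos s hs (by rw [sub_self, ← Prod.zero_eq_mk, map_zero])
    obtain ⟨_, ⟨t, ht, rfl⟩, h2⟩ := exists_lt_of_lt_csSup (⟨_, mem_image_of_mem _ hs⟩)
      (half_lt_self h0)
    obtain ⟨s', hs', h'⟩ := hcon t ht
    have := le_csSup (⟨b, by rintro _ ⟨u, hu, rfl⟩; exact hb u hu⟩ : BddAbove
      ((fun s' => r.gradPsi (s - s', 0)) '' S)) (mem_image_of_mem _ hs')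
    simp only at h2 this
    linarith
  rw [linearMinimizer, dif_pos h]
  exact h.choose_spec

end GradientReply

/-! ### Progress made by a single step -/

namespace StageProblem.UniformBound

variable {m n : ℕ} {P : StageProblem m n} {S : Set (Fin m → ℝ)} {Z : Set (Fin n → ℝ)} {R K : ℝ}

theorem radius_nonneg (hU : UniformBound P S Z R K) (hP : P.Admissible S Z) : 0 ≤ R := by
  obtain ⟨s, hs⟩ := hP.nonempty
  exact (norm_nonneg _).trans (hU.diam s hs s hs)

/-- The residual depends on the multiplier in a nonexpansive way. -/
theorem _root_.residual_lipschitz {t y y' : ℝ} (ht : t ∈ Icc (0 : ℝ) 1) :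
    t * max y' 0 + (1 - t) * max (-y') 0 ≤ t * max y 0 + (1 - t) * max (-y) 0 + |y' - y| := by
  have h1 : max y' 0 ≤ max y 0 + |y' - y| :=
    max_le (by linarith [le_max_left y 0, le_abs_self (y' - y)])
      (by linarith [le_max_right y 0, abs_nonneg (y' - y)])
  have h2 : max (-y') 0 ≤ max (-y) 0 + |y' - y| :=
    max_le (by linarith [le_max_left (-y) 0, neg_abs_le (y' - y)])
      (by linarith [le_max_right (-y) 0, abs_nonneg (y' - y)])
  nlinarith [mul_le_mul_of_nonneg_left h1 ht.1, mul_le_mul_of_nonneg_left h2 (sub_nonneg.2 ht.2)]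

theorem _root_.le_two_mul_of_sq_le {t E : ℝ} (hE : 0 ≤ E) (h : t ^ 2 ≤ 2 * E ^ 2) : t ≤ 2 * E :=
  (abs_le_of_sq_le_sq' (by nlinarith [sq_nonneg E]) (by positivity)).2

/-- E measures the progress on the scale cE². Small progress forces |τ| ≤ 2E for the change τ of zᵢ,
and either the right end is reached or |yᵢ| ≤ 2E. The multipliers from i on then move by at most
2K^(n+1)E. -/
theorem coordStep_spec (hU : UniformBound P S Z R K) (hP : P.Admissible S Z) {c : ℝ} (hc : 0 < c)
    (hcK : 2 * K * c ≤ 1) {x : (Fin m → ℝ) × (Fin n → ℝ)} (hx : x ∈ boxDomain n S) (i : Fin n) :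
    (P.gradientReply S x).coordStep c i x ∈ boxDomain n S ∧
      P.psi0 ((P.gradientReply S x).coordStep c i x) ≤ P.psi0 x ∧
      ∀ E : ℝ, 0 ≤ E → P.psi0 x - P.psi0 ((P.gradientReply S x).coordStep c i x) ≤ c * E ^ 2 →
        P.residual ((P.gradientReply S x).coordStep c i x).1
          ((P.gradientReply S x).coordStep c i x).2 i ≤ 4 * K ^ (n + 1) * E ∧
        ∀ j, i < j → P.residual ((P.gradientReply S x).coordStep c i x).1
          ((P.gradientReply S x).coordStep c i x).2 j ≤
            P.residual x.1 x.2 j + 4 * K ^ (n + 1) * E := by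
  obtain ⟨s, θ⟩ := x
  have hK := hU.one_le
  simp only [GradientReply.coordStep, hP.gradientReply_multiplier hx]
  have hcon := hP.forward_constraints hx i
  have hθi : θ i ∈ Icc (0 : ℝ) 1 := ⟨hx.2.1 i, hx.2.2 i⟩
  set y := P.multiplier s θ i with hy
  set d := (P.gradientReply S (s, θ)).valueEta i - (P.gradientReply S (s, θ)).valueMu i with hd
  have hd0 : 0 ≤ d := sub_nonneg.2 (hcon.1.trans hcon.2)
  obtain ⟨ha, h1, h2, h3⟩ := moveToEnd_spec (y := y) hc hd0 hθi
  set a := moveToEnd c y d (θ i) with haa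
  have hx' := update_mem_boxDomain hx i ha
  have hz : P.forward s (Function.update θ i a) i - P.forward s θ i = (a - θ i) * d := by
    rw [forward_eq P s (Function.update θ i a), forward_eq P s θ, before_forward_update]
    simp only [stageValue, Function.update_self, hd, gradientReply]
    ring
  have hdesc := hU.psi0_update_le hP hx i ha
  have hmul := fun j hij => hU.abs_multiplier_update_sub_le hP hx (i := i) (j := j) hij ha
  rw [hz] at hdesc
  simp only [hz] at hmul
  set τ := (a - θ i) * d with hτ
  -- Since |τ| ≤ c|y| and 2Kc ≤ 1, the quadratic error uses up at most half of the linear decrease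
  -- |y||τ|.
  have hdesc' : P.psi0 (s, Function.update θ i a) ≤ P.psi0 (s, θ) - |y| * |τ| / 2 := by
    have e1 : K * τ ^ 2 ≤ |y| * |τ| / 2 := by
      rw [← sq_abs τ]
      have e2 : K * |τ| ≤ |y| / 2 := by
        calc K * |τ| ≤ K * (c * |y|) := by gcongr
          _ = (2 * K * c) * (|y| / 2) := by ring
          _ ≤ 1 * (|y| / 2) := by gcongr
          _ = _ := one_mul _
      calc K * |τ| ^ 2 = K * |τ| * |τ| := by ring
        _ ≤ |y| / 2 * |τ| := by gcongr
        _ = _ := by ring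
    rw [h1] at hdesc
    linarith
  refine ⟨hx', hdesc'.trans (by linarith [mul_nonneg (abs_nonneg y) (abs_nonneg τ)]),
    fun E hE hcE => ?_⟩
  have hyτ : |y| * |τ| ≤ 2 * c * E ^ 2 := by linarith
  have hc1 : c ≤ 1 := by nlinarith
  have hτE : |τ| ≤ 2 * E := by
    refine le_two_mul_of_sq_le hE ?_
    calc |τ| ^ 2 = |τ| * |τ| := sq _
      _ ≤ c * |y| * |τ| := by gcongr
      _ = c * (|y| * |τ|) := mul_assoc _ _ _
      _ ≤ 1 * (2 * c * E ^ 2) := mul_le_mul hc1 hyτ (by positivity) zero_le_one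
      _ = c * (2 * E ^ 2) := by ring
      _ ≤ 1 * (2 * E ^ 2) := by gcongr
      _ = 2 * E ^ 2 := one_mul _
  have hKn : 1 ≤ K ^ (n + 1) := one_le_pow₀ hK
  have hmulE : ∀ j, i ≤ j → |P.multiplier s (Function.update θ i a) j - P.multiplier s θ j| ≤
      2 * K ^ (n + 1) * E := fun j hj => (hmul j hj).trans (by
    calc K ^ (n + 1) * |τ| ≤ K ^ (n + 1) * (2 * E) := by gcongr
      _ = _ := by ring)
  have hKE : E ≤ K ^ (n + 1) * E := le_mul_of_one_le_left hE hKn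
  refine ⟨?_, fun j hij => ?_⟩
  · simp only [residual, Function.update_self]
    refine (residual_lipschitz (y := y) ha).trans ?_
    have e1 := hmulE i le_rfl
    have e2 : a * max y 0 + (1 - a) * max (-y) 0 ≤ 2 * E := by
      rcases h3 with h3 | h3
      · rw [h3]; positivity
      · have e3 : |y| ≤ 2 * E := by
          refine le_two_mul_of_sq_le hE (le_of_mul_le_mul_left ?_ hc)
          rw [h3] at hyτ
          calc c * |y| ^ 2 = |y| * (c * |y|) := by ring
            _ ≤ 2 * c * E ^ 2 := hyτ
            _ = _ := by ring
        have e4 : max y 0 ≤ |y| := max_le (le_abs_self _) (abs_nonneg _)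
        have e5 : max (-y) 0 ≤ |y| := max_le (neg_le_abs _) (abs_nonneg _)
        have e6 := mul_le_mul_of_nonneg_left e4 ha.1
        have e7 := mul_le_mul_of_nonneg_left e5 (sub_nonneg.2 ha.2)
        linarith
    linarith
  · simp only [residual, Function.update_of_ne hij.ne']
    refine (residual_lipschitz (y := P.multiplier s θ j) ⟨hx.2.1 j, hx.2.2 j⟩).trans ?_
    have e1 := hmulE j hij.le
    have : 0 ≤ K ^ (n + 1) * E := by positivity
    linarith

/-- A Frank-Wolfe step of length cl along a direction of slope -l gains at least cl²/2, so small
progress gives l ≤ 2E; the factor 2 of the approximate minimizer makes this 4E. The factor (1+R)²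
covers both the quadratic error, which needs R², and cl ≤ 1, which makes the truncation at 1
inactive. -/
theorem stateStep_spec (hU : UniformBound P S Z R K) (hP : P.Admissible S Z) {c : ℝ} (hc : 0 < c)
    (hcK : 2 * K * (1 + R) ^ 2 * c ≤ 1) {x : (Fin m → ℝ) × (Fin n → ℝ)}
    (hx : x ∈ boxDomain n S) :
    (P.gradientReply S x).stateStep S c x ∈ boxDomain n S ∧
      P.psi0 ((P.gradientReply S x).stateStep S c x) ≤ P.psi0 x ∧
      ∀ E : ℝ, 0 ≤ E → P.psi0 x - P.psi0 ((P.gradientReply S x).stateStep S c x) ≤ c * E ^ 2 →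
        ∀ s' ∈ S, fderivWithin ℝ P.psi0 (boxDomain n S) x (x.1 - s', 0) ≤ 4 * E := by
  obtain ⟨s, θ⟩ := x
  have hK := hU.one_le
  have hR := hU.radius_nonneg hP
  obtain ⟨ht, hmin⟩ := (P.gradientReply S (s, θ)).linearMinimizer_spec hx.1
    (fun s' hs' => (le_abs_self _).trans (hU.abs_fderivWithin_psi0_le hP hx hs'))
  simp only [GradientReply.stateStep]
  set t := (P.gradientReply S (s, θ)).linearMinimizer S s with htt
  have hl := (le_abs_self _).trans (hU.abs_fderivWithin_psi0_le hP hx ht)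
  change fderivWithin ℝ P.psi0 (boxDomain n S) (s, θ) (s - t, 0) ≤ K * R at hl
  have hgrad : (P.gradientReply S (s, θ)).gradPsi =
    fderivWithin ℝ P.psi0 (boxDomain n S) (s, θ) := rfl
  rw [hgrad] at hmin ⊢
  have hl0 : 0 ≤ fderivWithin ℝ P.psi0 (boxDomain n S) (s, θ) (s - t, 0) := by
    have := hmin s hx.1
    rw [sub_self, ← Prod.zero_eq_mk, map_zero] at this
    linarith
  have hdesc := fun γ hγ => hU.psi0_add_smul_le hP hx ht (γ := γ) hγ
  set l := fderivWithin ℝ P.psi0 (boxDomain n S) (s, θ) (s - t, 0) with hll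
  have hKc : 0 < K * c := by positivity
  have hcl : c * l ≤ 1 := by nlinarith [mul_le_mul_of_nonneg_left hl hc.le]
  rw [min_eq_right hcl]
  have hγ : c * l ∈ Icc (0 : ℝ) 1 := ⟨by positivity, hcl⟩
  have hd := hdesc _ hγ
  have hd' : P.psi0 (s + (c * l) • (t - s), θ) ≤ P.psi0 (s, θ) - c * l ^ 2 / 2 := by
    have e1 : 2 * K * R ^ 2 * c ≤ 1 := by nlinarith
    have e2 : K * R ^ 2 * (c * l) ^ 2 = (2 * K * R ^ 2 * c) * (c * l ^ 2 / 2) := by ring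
    have e3 := mul_le_mul_of_nonneg_right e1 (by positivity : 0 ≤ c * l ^ 2 / 2)
    nlinarith
  refine ⟨⟨hP.convex.add_smul_sub_mem hx.1 ht hγ, hx.2⟩, hd'.trans ?_, fun E hE hcE s' hs' => ?_⟩
  · have : 0 ≤ c * l ^ 2 / 2 := by positivity
    linarith
  · have e1 : c * l ^ 2 ≤ c * (2 * E ^ 2) := by linarith
    have e2 := le_of_mul_le_mul_left e1 hc
    have e3 : l ≤ 2 * E := le_two_mul_of_sq_le hE e2
    exact (hmin s' hs').trans (by linarith)

end StageProblem.UniformBound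

/-! ### Step sizes and the number of sweeps -/

/-- The step size of the `k`-th sweep. -/
noncomputable def stepSize (ε : ℝ) (k : ℕ) : ℝ := 1 / (1 + √(k * ε))

theorem stepSize_pos (ε : ℝ) (k : ℕ) : 0 < stepSize ε k := by
  unfold stepSize; positivity

/-- From a sweep `k₀` on the steps are small, but large enough until the sweep `k₀ + p` for an
average progress of `A / p`, and `k₀ + p` is of the order `ε⁻³`. -/
theorem exists_sweep_count {c₀ κ : ℝ} (hc₀ : 0 < c₀) (hκ : 0 < κ) (A G : ℝ) (hG : 0 ≤ G) :
    ∃ C : ℝ, 0 ≤ C ∧ ∀ ε : ℝ, 0 < ε → ε ≤ G → ∃ (k₀ p : ℕ) (c : ℝ),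
      (∀ k, k₀ ≤ k → stepSize ε k ≤ c₀) ∧ (∀ k < k₀ + p, c ≤ stepSize ε k) ∧
      A < p * (c * (κ * ε ^ 2)) ∧ (k₀ + p : ℕ) ≤ C / ε ^ 3 := by
  -- B accounts for the k₀ initial sweeps and one rounding up, after multiplication with ε³.
  set B : ℝ := G ^ 2 / c₀ ^ 2 + G ^ 3 with hB
  have hB0 : 0 ≤ B := by positivity
  -- The three summands ensure G ≤ W, B ≤ W² and enough total progress.
  set W : ℝ := G + √B + 3 * (|A| + 1) / κ with hW
  have hW1 : 3 * (|A| + 1) / κ ≤ W := by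
    have := Real.sqrt_nonneg B
    rw [hW]; linarith
  have hκA : 0 < 3 * (|A| + 1) / κ := by positivity
  have hW0 : 0 < W := hκA.trans_le hW1
  have hGW : G ≤ W := by
    have := Real.sqrt_nonneg B
    rw [hW]; linarith
  have hBW : B ≤ W ^ 2 := by
    rw [← Real.sqrt_le_left hW0.le]
    rw [hW]; linarith
  refine ⟨W ^ 2 + B + G ^ 3, by positivity, fun ε hε hεG => ?_⟩
  set k₀ := ⌈1 / (c₀ ^ 2 * ε)⌉₊ with hk₀
  set p := ⌈W ^ 2 / ε ^ 3⌉₊ with hp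
  have hk1 : (k₀ : ℝ) < 1 / (c₀ ^ 2 * ε) + 1 := Nat.ceil_lt_add_one (by positivity)
  have hp1 : (p : ℝ) < W ^ 2 / ε ^ 3 + 1 := Nat.ceil_lt_add_one (by positivity)
  have hε2 : ε ^ 2 ≤ G ^ 2 := by gcongr
  have hε3 : ε ^ 3 ≤ G ^ 3 := by gcongr
  have e1 : 1 / (c₀ ^ 2 * ε) * ε ^ 3 ≤ G ^ 2 / c₀ ^ 2 := by
    rw [show 1 / (c₀ ^ 2 * ε) * ε ^ 3 = ε ^ 2 / c₀ ^ 2 by field_simp]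
    gcongr
  have e2 : W ^ 2 / ε ^ 3 * ε ^ 3 = W ^ 2 := div_mul_cancel₀ _ (by positivity)
  have hkp : ((k₀ + p : ℕ) : ℝ) * ε ^ 3 ≤ W ^ 2 + B + G ^ 3 := by
    have h1 := mul_le_mul_of_nonneg_right (add_le_add hk1.le hp1.le) (by positivity : 0 ≤ ε ^ 3)
    push_cast
    linarith
  -- The lower bound on the step size comes from 1 ≤ W/ε and √(kε) ≤ 2W/ε for k < k₀ + p.
  refine ⟨k₀, p, ε / (3 * W), fun k hk => ?_, fun k hk => ?_, ?_, ?_⟩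
  · have h1 : 1 / (c₀ ^ 2 * ε) ≤ k := (Nat.le_ceil _).trans (by exact_mod_cast hk)
    have h2 : 1 / c₀ ≤ √(k * ε) := by
      refine Real.le_sqrt_of_sq_le ?_
      calc (1 / c₀) ^ 2 = 1 / (c₀ ^ 2 * ε) * ε := by field_simp
        _ ≤ _ := by gcongr
    rw [stepSize, one_div_le (by positivity) hc₀]
    linarith
  · have h1 : ((k + 1 : ℕ) : ℝ) ≤ (k₀ + p : ℕ) := by exact_mod_cast hk
    have h2 : (k : ℝ) * ε ^ 3 ≤ W ^ 2 + B := by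
      have h3 := mul_le_mul_of_nonneg_right (add_le_add hk1.le hp1.le) (by positivity : 0 ≤ ε ^ 3)
      have h4 := mul_le_mul_of_nonneg_right h1 (by positivity : 0 ≤ ε ^ 3)
      push_cast at h4
      linarith
    have h3 : √(k * ε) ≤ 2 * W / ε := by
      refine Real.sqrt_le_iff.2 ⟨by positivity, ?_⟩
      rw [div_pow, le_div_iff₀ (by positivity)]
      calc (k : ℝ) * ε * ε ^ 2 = k * ε ^ 3 := by ring
        _ ≤ W ^ 2 + B := h2
        _ ≤ (2 * W) ^ 2 := by nlinarith [sq_nonneg W]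
    have h4 : 1 ≤ W / ε := (one_le_div hε).2 (hεG.trans hGW)
    rw [stepSize, le_div_iff₀ (by positivity)]
    calc ε / (3 * W) * (1 + √(k * ε)) ≤ ε / (3 * W) * (W / ε + 2 * W / ε) := by gcongr
      _ = 1 := by field_simp; norm_num
  · have h1 : W ^ 2 / ε ^ 3 ≤ p := Nat.le_ceil _
    calc A ≤ |A| := le_abs_self A
      _ < |A| + 1 := lt_add_one _
      _ = 3 * (|A| + 1) / κ * κ / 3 := by field_simp
      _ ≤ W * κ / 3 := by gcongr
      _ = W ^ 2 / ε ^ 3 * (ε / (3 * W) * (κ * ε ^ 2)) := by field_simp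
      _ ≤ _ := by gcongr
  · rwa [le_div_iff₀ (by positivity)]

/-! ### The algorithm, its trajectory and the complexity bound -/

/-- The state of the algorithm: the tolerance, the number of steps made, the current point, and
whether this point has been found to be good enough. -/
structure SweepState (m n : ℕ) where
  tol : ℝ
  round : ℕ
  point : (Fin m → ℝ) × (Fin n → ℝ)
  done : Bool

open Classical in
/-- Sweeps of coordinate steps in `θ` and a Frank-Wolfe step in `s`, until the duality gap is at
most the tolerance. -/
noncomputable def sweepAlgorithm {m n : ℕ} (S : Set (Fin m → ℝ)) (Z : Set (Fin n → ℝ))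
    (x₀ : (Fin m → ℝ) × (Fin n → ℝ)) : GradientAlgorithm m n where
  State := SweepState m n
  start ε := ⟨ε, 0, x₀, false⟩
  action st := if st.done then .output st.point else .compute st.point
  update st r :=
    if r.gap S Z st.point.1 (r.multiplier st.point.2) ≤ st.tol then
      ⟨st.tol, st.round, st.point, true⟩
    else ⟨st.tol, st.round + 1, r.sweepStep S (stepSize st.tol (st.round / (n + 1)))
      (st.round % (n + 1)) st.point, false⟩

namespace StageProblem

variable {m n : ℕ} {P : StageProblem m n} {S : Set (Fin m → ℝ)} {Z : Set (Fin n → ℝ)} {R K : ℝ}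

/-- The points that the algorithm visits if it does not terminate. -/
noncomputable def trajectory (P : StageProblem m n) (S : Set (Fin m → ℝ)) (ε : ℝ)
    (x₀ : (Fin m → ℝ) × (Fin n → ℝ)) : ℕ → (Fin m → ℝ) × (Fin n → ℝ)
  | 0 => x₀
  | t + 1 => (P.gradientReply S (trajectory P S ε x₀ t)).sweepStep S
      (stepSize ε (t / (n + 1))) (t % (n + 1)) (trajectory P S ε x₀ t)

theorem _root_.two_mul_mul_le_one {K R c : ℝ} (hK : 0 ≤ K) (hR : 0 ≤ R) (hc : 0 ≤ c)
    (h : 2 * K * (1 + R) ^ 2 * c ≤ 1) : 2 * K * c ≤ 1 := by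
  have h1 : 1 ≤ (1 + R) ^ 2 := one_le_pow₀ (by linarith)
  calc 2 * K * c = 2 * K * 1 * c := by ring
    _ ≤ 2 * K * (1 + R) ^ 2 * c := by gcongr
    _ ≤ 1 := h

theorem UniformBound.psi0_sweepStep_le (hU : UniformBound P S Z R K) (hP : P.Admissible S Z) {c : ℝ}
    (hc : 0 < c) (hcK : 2 * K * (1 + R) ^ 2 * c ≤ 1) (p : ℕ) {x : (Fin m → ℝ) × (Fin n → ℝ)}
    (hx : x ∈ boxDomain n S) :
    P.psi0 ((P.gradientReply S x).sweepStep S c p x) ≤ P.psi0 x := by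
  have hR := hU.radius_nonneg hP
  have hK := hU.one_le
  rw [GradientReply.sweepStep]
  split_ifs with hp
  · exact (hU.coordStep_spec hP hc (two_mul_mul_le_one (by linarith) hR hc.le hcK) hx _).2.1
  · exact (hU.stateStep_spec hP hc hcK hx).2.1

/-- Steps of any size stay in the domain. -/
theorem Admissible.sweepStep_mem (hP : P.Admissible S Z) {c : ℝ} (hc : 0 < c) (p : ℕ)
    {x : (Fin m → ℝ) × (Fin n → ℝ)} (hx : x ∈ boxDomain n S) :
    (P.gradientReply S x).sweepStep S c p x ∈ boxDomain n S := by
  obtain ⟨R, K, hU⟩ := hP.exists_uniformBound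
  obtain ⟨s, θ⟩ := x
  rw [GradientReply.sweepStep]
  split_ifs with hp
  · have hcon := hP.forward_constraints hx (Fin.rev ⟨p, hp⟩)
    exact update_mem_boxDomain hx _ (moveToEnd_spec hc (sub_nonneg.2 (hcon.1.trans hcon.2))
      ⟨hx.2.1 _, hx.2.2 _⟩).1
  · obtain ⟨ht, hmin⟩ := (P.gradientReply S (s, θ)).linearMinimizer_spec hx.1
      (fun s' hs' => (le_abs_self _).trans (hU.abs_fderivWithin_psi0_le hP hx hs'))
    have h0 := hmin s hx.1
    rw [sub_self, ← Prod.zero_eq_mk, map_zero] at h0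
    refine ⟨hP.convex.add_smul_sub_mem hx.1 ht ⟨le_min zero_le_one ?_, min_le_left _ _⟩, hx.2⟩
    exact mul_nonneg hc.le (by linarith)

theorem trajectory_mem (hP : P.Admissible S Z) {x₀ : (Fin m → ℝ) × (Fin n → ℝ)}
    (hx₀ : x₀ ∈ boxDomain n S) (ε : ℝ) (t : ℕ) : P.trajectory S ε x₀ t ∈ boxDomain n S := by
  induction t with
  | zero => exact hx₀
  | succ t ih => exact hP.sweepStep_mem (stepSize_pos _ _) _ ih

/-- After the coordinate steps of a sweep with little progress the duality gap is small. -/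
theorem UniformBound.dualityGap_le_of_progress_le (hU : UniformBound P S Z R K)
    (hP : P.Admissible S Z) {c E : ℝ} (hc : 0 < c) (hcK : 2 * K * (1 + R) ^ 2 * c ≤ 1) (hE : 0 ≤ E)
    (x : ℕ → (Fin m → ℝ) × (Fin n → ℝ)) (hmem : ∀ p, x p ∈ boxDomain n S)
    (hstep : ∀ p ≤ n, x (p + 1) = (P.gradientReply S (x p)).sweepStep S c p (x p))
    (hdesc : P.psi0 (x 0) - P.psi0 (x (n + 1)) ≤ c * E ^ 2) :
    P.dualityGap S Z (x n).1 (x n).2 ≤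
      ((2 * K + 4 * K * R) * (n * (n * (4 * K ^ (n + 1)))) + 4) * E := by
  have hR := hU.radius_nonneg hP
  have hK := hU.one_le
  have hcK' := two_mul_mul_le_one (by linarith) hR hc.le hcK
  have hmono : ∀ p ≤ n, P.psi0 (x (p + 1)) ≤ P.psi0 (x p) := fun p hp => by
    rw [hstep p hp]; exact hU.psi0_sweepStep_le hP hc hcK p (hmem p)
  have hup : ∀ p ≤ n + 1, P.psi0 (x p) ≤ P.psi0 (x 0) := by
    intro p
    induction p with
    | zero => intro _; exact le_rfl
    | succ p ih => intro hp; exact (hmono p (by omega)).trans (ih (by omega))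
  have hlow : ∀ p, p ≤ n + 1 → P.psi0 (x (n + 1)) ≤ P.psi0 (x p) := fun p hp => by
    induction hp using Nat.decreasingInduction with
    | self => exact le_rfl
    | of_succ p hp ih => exact ih.trans (hmono p (by omega))
  -- All steps of the sweep are descents, so none gains more than the whole sweep.
  have hone : ∀ p ≤ n, P.psi0 (x p) - P.psi0 (x (p + 1)) ≤ c * E ^ 2 := fun p hp => by
    linarith [hup p (by omega), hlow (p + 1) (by omega)]
  set M := 4 * K ^ (n + 1) with hM
  have hM0 : 0 ≤ M := by positivity
  -- After p steps the last p coordinates have been treated, and each step adds at most ME to the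
  -- residuals already made small.
  have hres : ∀ p ≤ n, ∀ j : Fin n, n ≤ j + p → P.residual (x p).1 (x p).2 j ≤ p * (M * E) := by
    intro p
    induction p with
    | zero => intro _ j hj; exact absurd j.2 (by omega)
    | succ p ih =>
      intro hp j hj
      have hs := hstep p (by omega)
      rw [GradientReply.sweepStep, dif_pos (by omega)] at hs
      have hd := hone p (by omega)
      have hspec := (hU.coordStep_spec hP hc hcK' (hmem p) (Fin.rev ⟨p, by omega⟩)).2.2 E hE
      rw [← hs, ← hM] at hspec
      obtain ⟨h1, h2⟩ := hspec hd
      push_cast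
      have hME : 0 ≤ M * E := by positivity
      have hpME : 0 ≤ p * (M * E) := by positivity
      rcases eq_or_ne j (Fin.rev ⟨p, by omega⟩) with heq | hne
      · rw [heq]
        linarith
      · have hv : (j : ℕ) ≠ n - (p + 1) := fun h => hne (Fin.ext (by simpa [Fin.val_rev] using h))
        have hlt : Fin.rev ⟨p, by omega⟩ < j := by
          rw [Fin.lt_def, Fin.val_rev]
          simp only
          omega
        linarith [h2 j hlt, ih (by omega) j (by omega)]
  have hs := hstep n le_rfl
  rw [GradientReply.sweepStep, dif_neg (lt_irrefl n)] at hs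
  have hspec := (hU.stateStep_spec hP hc hcK (hmem n)).2.2 E hE
  rw [← hs] at hspec
  -- The gap is small before the step in s: the residuals are controlled there, and the small gain
  -- of that step bounds the Frank-Wolfe gap at its starting point.
  have hgap := hU.dualityGap_le hP (hmem n) (hspec (hone n le_rfl))
  have hsum : ∑ i, P.residual (x n).1 (x n).2 i ≤ n * (n * (M * E)) := by
    refine (Finset.sum_le_sum fun i _ => hres n le_rfl i (by omega)).trans ?_
    simp
  have : 0 ≤ 2 * K + 4 * K * R := by positivity
  calc _ ≤ _ := hgap
    _ ≤ (2 * K + 4 * K * R) * (n * (n * (M * E))) + 4 * E := by gcongr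
    _ = _ := by ring

theorem trajectory_sweep (P : StageProblem m n) (S : Set (Fin m → ℝ)) (ε : ℝ)
    (x₀ : (Fin m → ℝ) × (Fin n → ℝ)) (k : ℕ) {p : ℕ} (hp : p ≤ n) :
    P.trajectory S ε x₀ ((n + 1) * k + (p + 1)) =
      (P.gradientReply S (P.trajectory S ε x₀ ((n + 1) * k + p))).sweepStep S (stepSize ε k) p
        (P.trajectory S ε x₀ ((n + 1) * k + p)) := by
  have h1 : ((n + 1) * k + p) / (n + 1) = k := by
    rw [Nat.mul_add_div (Nat.succ_pos n), Nat.div_eq_of_lt (by omega), add_zero]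
  have h2 : ((n + 1) * k + p) % (n + 1) = p := by
    rw [Nat.mul_add_mod, Nat.mod_eq_of_lt (by omega)]
  rw [← add_assoc, trajectory, h1, h2]

/-- Some point among the first `O(ε⁻³)` ones of the trajectory has a small duality gap. -/
theorem Admissible.exists_dualityGap_le (hP : P.Admissible S Z) {x₀ : (Fin m → ℝ) × (Fin n → ℝ)}
    (hx₀ : x₀ ∈ boxDomain n S) : ∃ C : ℝ, 0 ≤ C ∧ ∀ ε : ℝ, 0 < ε → ∃ t : ℕ,
      ((t + 1 : ℕ) : ℝ) ≤ C / ε ^ 3 + 1 ∧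
      P.dualityGap S Z (P.trajectory S ε x₀ t).1 (P.trajectory S ε x₀ t).2 ≤ ε := by
  obtain ⟨R, K, hU⟩ := hP.exists_uniformBound
  have hR := hU.radius_nonneg hP
  have hK := hU.one_le
  set W := (2 * K + 4 * K * R) * (n * (n * (4 * K ^ (n + 1)))) + 4 with hW
  have hW0 : 0 < W := by positivity
  -- c₀ is the step size below which all steps are descents, 2K bounds the oscillation of ψ₀, and G
  -- is the initial gap.
  obtain ⟨C, hC0, hC⟩ := exists_sweep_count (c₀ := 1 / (2 * K * (1 + R) ^ 2)) (κ := 1 / W ^ 2)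
    (by positivity) (by positivity) (2 * K) (max 0 (P.dualityGap S Z x₀.1 x₀.2)) (le_max_left _ _)
  refine ⟨(n + 1) * C, by positivity, fun ε hε => ?_⟩
  -- If the first point already passes, the summand +1 pays for its computation. Otherwise ε is
  -- below the initial gap, which gives the upper bound on ε needed for the count.
  by_cases hstart : P.dualityGap S Z x₀.1 x₀.2 ≤ ε
  · refine ⟨0, ?_, hstart⟩
    have : 0 ≤ (n + 1) * C / ε ^ 3 := by positivity
    push_cast
    linarith
  obtain ⟨k₀, p, c, hsmall, hlarge, hprog, hcount⟩ :=
    hC ε hε (le_max_of_le_right (not_le.1 hstart).le)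
  set x := P.trajectory S ε x₀ with hx
  have hmem : ∀ t, x t ∈ boxDomain n S := trajectory_mem hP hx₀ ε
  by_contra! hcon
  have hbig : ∀ k < k₀ + p,
      ε < P.dualityGap S Z (x ((n + 1) * k + n)).1 (x ((n + 1) * k + n)).2 := by
    intro k hk
    refine hcon _ ?_
    have h1 : (n + 1) * k + n + 1 ≤ (n + 1) * (k₀ + p) := by
      calc (n + 1) * k + n + 1 = (n + 1) * (k + 1) := by ring
        _ ≤ _ := Nat.mul_le_mul_left _ hk
    have h2 : (((n + 1) * k + n + 1 : ℕ) : ℝ) ≤ ((n + 1) * (k₀ + p) : ℕ) := by exact_mod_cast h1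
    refine h2.trans ?_
    rw [Nat.cast_mul, mul_div_assoc]
    push_cast at hcount ⊢
    have : ((n : ℝ) + 1) * (k₀ + p) ≤ (n + 1) * (C / ε ^ 3) := by gcongr
    linarith
  -- With E = ε/W, a smaller decrease would bring the gap in this sweep down to ε.
  have hdec : ∀ k, k₀ ≤ k → k < k₀ + p → P.psi0 (x ((n + 1) * (k + 1))) ≤
      P.psi0 (x ((n + 1) * k)) - c * (1 / W ^ 2 * ε ^ 2) := by
    intro k hk hkp
    by_contra! hlt
    have hc := stepSize_pos ε k
    have hcK : 2 * K * (1 + R) ^ 2 * stepSize ε k ≤ 1 := by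
      have := hsmall k hk
      rwa [le_div_iff₀ (by positivity), mul_comm] at this
    have h := hU.dualityGap_le_of_progress_le hP hc hcK (E := ε / W) (by positivity)
      (fun q => x ((n + 1) * k + q)) (fun q => hmem _)
      (fun q hq => trajectory_sweep P S ε x₀ k hq) (by
        have h1 : c * (1 / W ^ 2 * ε ^ 2) ≤ stepSize ε k * (ε / W) ^ 2 := by
          rw [div_pow, one_div_mul_eq_div]
          gcongr
          exact hlarge k hkp
        rw [show (n + 1) * k + (n + 1) = (n + 1) * (k + 1) by ring, add_zero]
        linarith)
    rw [← hW, mul_div_cancel₀ _ hW0.ne'] at h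
    exact (hbig k hkp).not_ge h
  have htotal : ∀ q ≤ p, P.psi0 (x ((n + 1) * (k₀ + q))) ≤
      P.psi0 (x ((n + 1) * k₀)) - q * (c * (1 / W ^ 2 * ε ^ 2)) := by
    intro q
    induction q with
    | zero => intro _; simp
    | succ q ih =>
      intro hq
      have h1 := hdec (k₀ + q) (by omega) (by omega)
      have h2 := ih (by omega)
      push_cast
      rw [← add_assoc]
      linarith
  have h1 := htotal p le_rfl
  have h2 := abs_le.1 (hU.abs_psi0_le (hmem ((n + 1) * (k₀ + p))))
  -- The sweeps before k₀ may have increased ψ₀; its uniform bound makes this harmless.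
  have h3 := abs_le.1 (hU.abs_psi0_le (hmem ((n + 1) * k₀)))
  linarith

/-! ### Execution of the algorithm -/

theorem Admissible.gap_gradientReply (hP : P.Admissible S Z) {x : (Fin m → ℝ) × (Fin n → ℝ)}
    (hx : x ∈ boxDomain n S) :
    (P.gradientReply S x).gap S Z x.1 ((P.gradientReply S x).multiplier x.2) =
      P.dualityGap S Z x.1 x.2 := by
  rw [dualityGap_eq_gap hP hx]
  congr 1
  exact funext fun k => hP.gradientReply_multiplier hx k

theorem Admissible.stateAfter_eq (hP : P.Admissible S Z) {x₀ : (Fin m → ℝ) × (Fin n → ℝ)}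
    (hx₀ : x₀ ∈ boxDomain n S) (ε : ℝ) (t : ℕ)
    (h : ∀ k < t, ε < P.dualityGap S Z (P.trajectory S ε x₀ k).1 (P.trajectory S ε x₀ k).2) :
    (sweepAlgorithm S Z x₀).stateAfter P S ε t =
      (⟨ε, t, P.trajectory S ε x₀ t, false⟩ : SweepState m n) := by
  induction t with
  | zero => rfl
  | succ t ih =>
    rw [GradientAlgorithm.stateAfter, ih fun k hk => h k (by omega)]
    simp only [sweepAlgorithm, Bool.false_eq_true, if_false]
    rw [hP.gap_gradientReply (trajectory_mem hP hx₀ ε t), if_neg (not_le.2 (h t (by omega)))]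
    rfl

/-- The successful test at the t-th point itself uses a reply, hence t + 1 computations. -/
theorem Admissible.returnsAfter (hP : P.Admissible S Z) {x₀ : (Fin m → ℝ) × (Fin n → ℝ)}
    (hx₀ : x₀ ∈ boxDomain n S) (ε : ℝ) (t : ℕ)
    (h : ∀ k < t, ε < P.dualityGap S Z (P.trajectory S ε x₀ k).1 (P.trajectory S ε x₀ k).2)
    (ht : P.dualityGap S Z (P.trajectory S ε x₀ t).1 (P.trajectory S ε x₀ t).2 ≤ ε) :
    (sweepAlgorithm S Z x₀).ReturnsAfter P S ε (t + 1) (P.trajectory S ε x₀ t) := by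
  refine ⟨fun k hk => ⟨_, trajectory_mem hP hx₀ ε k, ?_⟩, ?_⟩
  · rw [hP.stateAfter_eq hx₀ ε k fun l hl => h l (by omega)]
    simp [sweepAlgorithm]
  · rw [GradientAlgorithm.stateAfter, hP.stateAfter_eq hx₀ ε t h]
    simp only [sweepAlgorithm, Bool.false_eq_true, if_false]
    rw [hP.gap_gradientReply (trajectory_mem hP hx₀ ε t), if_pos ht]
    rfl

end StageProblem

theorem mainTheorem6 (m n : ℕ) (S : Set (Fin m → ℝ)) (Z : Set (Fin n → ℝ))
    (hSne : S.Nonempty) (hSconv : Convex ℝ S)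
    (hSbdd : Bornology.IsBounded S) (hZbdd : Bornology.IsBounded Z) :
    ∃ A : GradientAlgorithm m n, ∀ P : StageProblem m n,
      ConvexOn ℝ (S ×ˢ univ) P.f →
      (∀ i, ConvexOn ℝ (S ×ˢ univ) (P.μ i)) →
      (∀ i, ConcaveOn ℝ (S ×ˢ univ) (P.η i)) →
      SmoothOn (S ×ˢ univ) P.f →
      (∀ i, SmoothOn (S ×ˢ univ) (P.μ i)) →
      (∀ i, SmoothOn (S ×ˢ univ) (P.η i)) →
      (∀ s z, P.Feasible S s z → z ∈ Z) →
      P.InductivelyFeasible S →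
      ∃ C : ℝ, ∀ ε : ℝ, 0 < ε →
        ∃ (N : ℕ) (s : Fin m → ℝ) (θ : Fin n → ℝ),
          A.ReturnsAfter P S ε N (s, θ) ∧
          (N : ℝ) ≤ C / ε ^ 3 + 1 ∧
          (s, θ) ∈ boxDomain n S ∧
          P.Feasible S s (P.forward s θ) ∧
          P.dualityGap S Z s θ ≤ ε ∧
          (∀ x ∈ S ×ˢ Z,
            P.f (s, P.forward s θ) - ε ≤ P.lagrangian (P.multiplier s θ) x) ∧
          (∀ s' z', P.Feasible S s' z' → P.f (s, P.forward s θ) - ε ≤ P.f (s', z')) := by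
  obtain ⟨s₀, hs₀⟩ := hSne
  refine ⟨sweepAlgorithm S Z (s₀, 0), fun P hf hμ hη sf sμ sη hfeas hind => ?_⟩
  -- For real-valued functions `SmoothOn` and `SmoothMapOn` agree by definition.
  have hP : P.Admissible S Z :=
    ⟨⟨s₀, hs₀⟩, hSconv, hSbdd, hZbdd, hf, hμ, hη, sf, sμ, sη, hfeas, hind⟩
  have hx₀ : (s₀, (0 : Fin n → ℝ)) ∈ boxDomain n S := ⟨hs₀, by simp⟩
  obtain ⟨C, -, hC⟩ := hP.exists_dualityGap_le hx₀
  refine ⟨C, fun ε hε => ?_⟩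
  classical
  obtain ⟨t, htC, ht⟩ := hC ε hε
  have hex : ∃ t, P.dualityGap S Z (P.trajectory S ε (s₀, 0) t).1
    (P.trajectory S ε (s₀, 0) t).2 ≤ ε := ⟨t, ht⟩
  -- The algorithm stops at the first point that passes the test, possibly earlier than t.
  have hmin := fun k (hk : k < Nat.find hex) => not_le.1 (Nat.find_min hex hk)
  have hN := Nat.find_spec hex
  have hmem := P.trajectory_mem hP hx₀ ε (Nat.find hex)
  have hle : Nat.find hex ≤ t := Nat.find_min' hex ht
  have hL : ∀ x ∈ S ×ˢ Z, P.f ((P.trajectory S ε (s₀, 0) (Nat.find hex)).1, P.forward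
      (P.trajectory S ε (s₀, 0) (Nat.find hex)).1 (P.trajectory S ε (s₀, 0) (Nat.find hex)).2) - ε ≤
      P.lagrangian (P.multiplier (P.trajectory S ε (s₀, 0) (Nat.find hex)).1
        (P.trajectory S ε (s₀, 0) (Nat.find hex)).2) x := fun x hx =>
    (sub_le_sub_left hN _).trans (StageProblem.sub_dualityGap_le_lagrangian hP hmem hx)
  refine ⟨Nat.find hex + 1, _, _, hP.returnsAfter hx₀ ε _ hmin hN, ?_, hmem,
    hP.feasible_forward hmem, hN, hL, fun s' z' h => ?_⟩
  · refine le_trans ?_ htC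
    exact_mod_cast Nat.succ_le_succ hle
  · exact (hL (s', z') ⟨h.1, hfeas s' z' h⟩).trans (StageProblem.lagrangian_le_of_feasible _ h)
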